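/- **Setting.** Consider a Runge–Kutta method with $s\ge 1$ stages, real coefficients $A\in\mathbb R^{s\times s}$, $b\in\mathbb R^s$, and put $$r(z)=1+z\,b^T(I-zA)^{-1}\mathbb 1,\qquad q(z)=b^T(I-zA)^{-1},\qquad \mathbb 1=(1,\dots,1)^T .$$ Assume that it is $A$-stable ($I-zA$ is invertible and $|r(z)|\le 1$ for $\operatorname{Re}z\le 0$), of classical order at least one ($\sum_i b_i=1$), that $|r(iy)|<1$ for all real $y\ne 0$, that $A$ is invertible, and that $b^TA^{-1}=(0,\dots,0,1)$. Let $\Delta(\zeta)=\bigl(A+\frac{\zeta}{1-\zeta}\mathbb 1b^T\bigr)^{-1}$, define $E_n(z)$ by $(\Delta(\zeta)-zI)^{-1}=\sum_{n\ge0}E_n(z)\zeta^n$ near $\zeta=0$, and let $e_n(z)$ be the last row of $E_n(z)$ (so $e_n(z)=r(z)^nq(z)$). For $\xi>0$ let $$\gamma(\xi)=\inf_{-\xi\le\operatorname{Re}z<0}\frac{\log|r(z)|}{\operatorname{Re}z},$$ where the quotient is read as $+\infty$ if $r(z)=0$. Let $K(z,x)=\frac{1}{2\sqrt{z/i}}\,e^{-|x|\sqrt{z/i}}$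 with $\sqrt{z/i}=e^{-i\pi/4}\sqrt z$ be the transfer operator of the one-dimensional Schrödinger equation, $x\in\mathbb R$, $d=|x|$, and for $\lambda>0$ let $G(\lambda,x)=K(\lambda e^{-i\pi},x)-K(\lambda e^{i\pi},x)$ be the difference of its values on the lower and the upper side of the branch cut $(-\infty,0]$. Let $h>0$, $t_n=nh$, $B\ge1$, $L_0>0$, $L_j=(1+B)L_{j-1}$ for $j\ge1$, and $$I_{n,j}=\frac{h}{2\pi i}\int_{L_{j-1}}^{L_j}G(\lambda,x)\,e_n(-h\lambda)\,d\lambda .$$ Let $\tau_{n,j}(Q)$ be the error in the approximation of $I_{n,j}$ by the $Q$-node Gauss–Legendre rule transplanted affinely from $[-1,1]$ to $[L_{j-1},L_j]$. Let $\|\cdot\|$ be any norm on row vectors in $\mathbb C^s$, and $$C_{q}=\sup_{\operatorname{Re}z\le0}\|q(z)\| .$$ **Corollary 4.6.** $C_q<\infty$, and for all $n\ge0$, $j\ge1$, $Q\ge1$ and all $x,h,B,L_0$ as above $$\|\tau_{n,j}(Q)\|\le C_{q}\,h\,\frac{2BL_{j-1}^{1/2}}{\pi}\min_{\varrho\in(1,\varrho_{\max})}\frac{\varrho^{-2Q+1}}{\varrho-1}\,\eta_-^{-1/2}\exp\Bigl(dL_{j-1}^{1/2}\bigl(1+(\varrho/2)^2\bigr)^{1/4}\eta_+^{1/2}-L_{j-1}t_n\,\gamma(hL_{j-1}\eta_+)\,\eta_-\Bigr),$$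 where the minimum is attained and $$\eta_\pm=1+\tfrac B4\bigl(\pm(\varrho+\varrho^{-1})+2\bigr),\qquad \varrho_{\max}=1+\tfrac2B\bigl(1+\sqrt{1+B}\bigr).$$ -/

import Mathlib

open scoped Polynomial

noncomputable section

namespace SchrodingerCQ

/-! ### Gauss-Legendre quadrature on `[-1, 1]` -/

/-- The Gauss quadrature formula with weight function `1` and `Q` nodes on `[-1, 1]`: `Q` distinct
nodes in `[-1, 1]` and `Q` real weights for which the formula integrates every polynomial of degree
less than `2 Q` exactly. -/
structure GaussLegendreRule (Q : ℕ) where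
  node : Fin Q → ℝ
  weight : Fin Q → ℝ
  node_injective : Function.Injective node
  node_mem : ∀ k, node k ∈ Set.Icc (-1 : ℝ) 1
  exact : ∀ p : ℝ[X], p.natDegree < 2 * Q →
    ∑ k, weight k * p.eval (node k) = ∫ x in (-1 : ℝ)..1, p.eval x

/-- Integration over `[-1, 1]` as a linear functional on polynomials. -/
def integralPoly : ℝ[X] →ₗ[ℝ] ℝ where
  toFun p := ∫ x in (-1 : ℝ)..1, p.eval x
  map_add' p q := by
    simp only [Polynomial.eval_add]
    exact intervalIntegral.integral_add (p.continuous.intervalIntegrable _ _)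
      (q.continuous.intervalIntegrable _ _)
  map_smul' c p := by simp

theorem integralPoly_pos {p : ℝ[X]} (h0 : p ≠ 0)
    (hp : ∀ x ∈ Set.Icc (-1 : ℝ) 1, 0 ≤ p.eval x) : 0 < integralPoly p := by
  refine intervalIntegral.integral_pos (by norm_num) p.continuous.continuousOn
    (fun x hx => hp x ⟨hx.1.le, hx.2⟩) ?_
  by_contra! hc
  refine h0 (Polynomial.eq_zero_of_infinite_isRoot p ?_)
  refine Set.Infinite.mono (s := Set.Icc (-1 : ℝ) 1) (fun x hx => ?_)
    (Set.Icc_infinite (by norm_num))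
  exact le_antisymm (hc x hx) (hp x hx)

theorem exists_monic_orthogonal (Q : ℕ) :
    ∃ P : ℝ[X], P.Monic ∧ P.natDegree = Q ∧
      ∀ q : ℝ[X], q.degree < (Q : WithBot ℕ) → integralPoly (P * q) = 0 := by
  let V := Polynomial.degreeLT ℝ Q
  have : FiniteDimensional ℝ V :=
    Module.Finite.equiv (Polynomial.degreeLTEquiv ℝ Q).symm
  let T : V →ₗ[ℝ] Module.Dual ℝ V :=
    { toFun := fun p => integralPoly ∘ₗ (LinearMap.mulLeft ℝ (p : ℝ[X])) ∘ₗ V.subtype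
      map_add' := fun p q => by ext r; simp [add_mul]
      map_smul' := fun c p => by ext r; simp }
  have hinj : Function.Injective T := by
    rw [← LinearMap.ker_eq_bot, LinearMap.ker_eq_bot']
    intro p hp
    by_contra hne
    have h1 : T p p = 0 := by rw [hp]; rfl
    have h2 : (p : ℝ[X]) ≠ 0 := fun h => hne (Subtype.ext h)
    have h3 : 0 < integralPoly ((p : ℝ[X]) * p) :=
      integralPoly_pos (mul_ne_zero h2 h2)
        (fun x _ => by rw [Polynomial.eval_mul]; exact mul_self_nonneg _)
    exact h3.ne' h1
  have hsurj : Function.Surjective T :=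
    (LinearMap.injective_iff_surjective_of_finrank_eq_finrank
      (Subspace.dual_finrank_eq (K := ℝ) (V := V)).symm).1 hinj
  obtain ⟨p, hp⟩ := hsurj
    (integralPoly ∘ₗ (LinearMap.mulLeft ℝ (Polynomial.X ^ Q : ℝ[X])) ∘ₗ V.subtype)
  have hdeg : (p : ℝ[X]).degree < (Q : WithBot ℕ) := Polynomial.mem_degreeLT.1 p.2
  refine ⟨Polynomial.X ^ Q - (p : ℝ[X]), ?_, ?_, ?_⟩
  · exact (Polynomial.monic_X_pow Q).sub_of_left (by simpa using hdeg)
  · apply Polynomial.natDegree_eq_of_degree_eq_some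
    rw [Polynomial.degree_sub_eq_left_of_degree_lt (by rw [Polynomial.degree_X_pow]; exact hdeg),
      Polynomial.degree_X_pow]
  · intro q hq
    have := LinearMap.congr_fun hp ⟨q, Polynomial.mem_degreeLT.2 hq⟩
    have h4 : integralPoly ((p : ℝ[X]) * q) = integralPoly (Polynomial.X ^ Q * q) := this
    rw [sub_mul, map_sub, h4, sub_self]

theorem exists_orthogonal_with_nodes (Q : ℕ) :
    ∃ P : ℝ[X], P.Monic ∧ P.natDegree = Q ∧
      (∀ q : ℝ[X], q.degree < (Q : WithBot ℕ) → integralPoly (P * q) = 0) ∧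
      P.roots.Nodup ∧ P.roots.card = Q ∧ ∀ a ∈ P.roots, a ∈ Set.Icc (-1 : ℝ) 1 := by
  obtain ⟨P, hm, hd, ho⟩ := exists_monic_orthogonal Q
  have hP0 : P ≠ 0 := hm.ne_zero
  have key : ∀ f h : ℝ[X], f * h = P → 0 < f.natDegree →
      ¬ ((∀ x ∈ Set.Icc (-1 : ℝ) 1, 0 ≤ f.eval x) ∨ ∀ x ∈ Set.Icc (-1 : ℝ) 1, f.eval x ≤ 0) := by
    intro f h hfh hf hs
    have hf0 : f ≠ 0 := fun h0 => by simp [h0] at hf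
    have hh0 : h ≠ 0 := fun h0 => hP0 (by rw [← hfh, h0, mul_zero])
    have hdeg : f.natDegree + h.natDegree = Q := by
      rw [← hd, ← hfh, Polynomial.natDegree_mul hf0 hh0]
    have hz : integralPoly (P * h) = 0 := ho h (by
      rw [Polynomial.degree_eq_natDegree hh0]; exact_mod_cast (by omega))
    rcases hs with hs | hs
    · refine (integralPoly_pos (p := P * h) (mul_ne_zero hP0 hh0) fun x hx => ?_).ne' hz
      rw [← hfh, Polynomial.eval_mul, Polynomial.eval_mul, mul_assoc]
      exact mul_nonneg (hs x hx) (mul_self_nonneg _)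
    · have hz' : integralPoly (-(P * h)) = 0 := by rw [map_neg, hz, neg_zero]
      refine (integralPoly_pos (p := -(P * h)) (neg_ne_zero.2 (mul_ne_zero hP0 hh0))
        fun x hx => ?_).ne' hz'
      rw [← hfh, Polynomial.eval_neg, Polynomial.eval_mul, Polynomial.eval_mul, mul_assoc,
        ← neg_mul]
      exact mul_nonneg (neg_nonneg.2 (hs x hx)) (mul_self_nonneg _)
  refine ⟨P, hm, hd, ho, ?_, ?_, ?_⟩
  · rw [Multiset.nodup_iff_count_le_one]
    intro a
    by_contra! hc
    rw [Polynomial.count_roots] at hc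
    have hdvd : (Polynomial.X - Polynomial.C a) ^ 2 ∣ P :=
      (pow_dvd_pow _ hc).trans (Polynomial.pow_rootMultiplicity_dvd P a)
    obtain ⟨h, hh⟩ := hdvd
    refine key _ h hh.symm (by simp) (Or.inl fun x _ => ?_)
    rw [Polynomial.eval_pow]
    exact sq_nonneg _
  · obtain ⟨q, hq, hcard, hroots⟩ := Polynomial.exists_prod_multiset_X_sub_C_mul P
    by_contra hne
    have hq0 : q ≠ 0 := fun h0 => hP0 (by rw [← hq, h0, mul_zero])
    have hnr : ∀ x : ℝ, q.eval x ≠ 0 := fun x hx => by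
      have : x ∈ q.roots := (Polynomial.mem_roots hq0).2 hx
      simp [hroots] at this
    refine key q _ (by rw [mul_comm]; exact hq) (by omega) ?_
    by_contra! hc
    obtain ⟨⟨x, -, hx⟩, y, -, hy⟩ := hc
    obtain ⟨z, -, hz⟩ := (isPreconnected_univ (α := ℝ)).intermediate_value
      (Set.mem_univ x) (Set.mem_univ y) q.continuous.continuousOn ⟨hx.le, hy.le⟩
    exact hnr z hz
  · intro a ha
    have hr : P.IsRoot a := (Polynomial.mem_roots hP0).1 ha
    obtain ⟨h, hh⟩ := Polynomial.dvd_iff_isRoot.2 hr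
    have := key _ h hh.symm (by simp)
    by_contra hmem
    apply this
    rcases lt_or_ge a (-1) with h1 | h1
    · left
      intro x hx
      simp only [Polynomial.eval_sub, Polynomial.eval_X, Polynomial.eval_C]
      linarith [hx.1]
    · right
      intro x hx
      have h2 : 1 < a := by
        by_contra! h2
        exact hmem ⟨h1, h2⟩
      simp only [Polynomial.eval_sub, Polynomial.eval_X, Polynomial.eval_C]
      linarith [hx.2]

/-- The Gauss-Legendre rule exists for every number of nodes. -/
instance gaussLegendreRule_nonempty (Q : ℕ) : Nonempty (GaussLegendreRule Q) := by
  obtain ⟨P, hm, hd, ho, hnd, hcard, hmem⟩ := exists_orthogonal_with_nodes Q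
  have hfc : P.roots.toFinset.card = Q := by rw [Multiset.toFinset_card_of_nodup hnd, hcard]
  let e := (P.roots.toFinset.equivFinOfCardEq hfc).symm
  let v : Fin Q → ℝ := fun k => (e k : ℝ)
  have hv : Function.Injective v := fun i j hij => e.injective (Subtype.ext hij)
  have hvr : ∀ k, v k ∈ P.roots := fun k => Multiset.mem_toFinset.1 (e k).2
  refine ⟨⟨v, fun k => integralPoly (Lagrange.basis Finset.univ v k), hv,
    fun k => hmem _ (hvr k), fun p hp => ?_⟩⟩
  change _ = integralPoly p
  set r := p %ₘ P with hr
  have hpr : r + P * (p /ₘ P) = p := Polynomial.modByMonic_add_div p P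
  have hq : (p /ₘ P).degree < (Q : WithBot ℕ) := by
    rcases Nat.eq_zero_or_pos Q with hQ | hQ
    · omega
    · refine lt_of_le_of_lt Polynomial.degree_le_natDegree ?_
      rw [Polynomial.natDegree_divByMonic p hm, hd]
      exact_mod_cast (by omega)
  have hrd : r.degree < ((Finset.univ : Finset (Fin Q)).card : WithBot ℕ) := by
    have := Polynomial.degree_modByMonic_lt p hm
    rw [Polynomial.degree_eq_natDegree hm.ne_zero, hd] at this
    simpa using this
  have hint : integralPoly p = integralPoly r := by
    rw [← hpr, map_add, ho _ hq, add_zero]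
  have hev : ∀ k, p.eval (v k) = r.eval (v k) := fun k => by
    have h0 : P.eval (v k) = 0 := (Polynomial.mem_roots hm.ne_zero).1 (hvr k)
    conv_lhs => rw [← hpr]
    rw [Polynomial.eval_add, Polynomial.eval_mul, h0, zero_mul, add_zero]
  have hlag := Lagrange.eq_interpolate (s := Finset.univ) (v := v) hv.injOn hrd
  rw [hint]
  conv_rhs => rw [hlag, Lagrange.interpolate_apply, map_sum]
  refine Finset.sum_congr rfl fun k _ => ?_
  rw [hev k, ← Polynomial.smul_eq_C_mul, map_smul, smul_eq_mul, mul_comm]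

/-! ### Runge-Kutta methods -/

/-- The Butcher coefficients `A`, `b` of a Runge-Kutta method with `m + 1` stages. The abscissae `c`
do not enter the convolution weights and are not recorded. -/
structure RungeKutta (m : ℕ) where
  A : Matrix (Fin (m + 1)) (Fin (m + 1)) ℝ
  b : Fin (m + 1) → ℝ

namespace RungeKutta

variable {m : ℕ} (R : RungeKutta m)

/-- The coefficient matrix, viewed over `ℂ`. -/
def AC : Matrix (Fin (m + 1)) (Fin (m + 1)) ℂ := R.A.map Complex.ofReal

/-- The weights, viewed over `ℂ`. -/
def bC : Fin (m + 1) → ℂ := fun i => (R.b i : ℂ)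

/-- The stability function `r(z) = 1 + z bᵀ (I - z A)⁻¹ 𝟙`. -/
def stab (z : ℂ) : ℂ :=
  1 + z * dotProduct R.bC (Matrix.mulVec (1 - z • R.AC)⁻¹ (fun _ => 1))

/-- The row vector `q(z) = bᵀ (I - z A)⁻¹`. -/
def q (z : ℂ) : Fin (m + 1) → ℂ := Matrix.vecMul R.bC (1 - z • R.AC)⁻¹

/-- The symbol `Δ(ζ) = (A + ζ / (1 - ζ) 𝟙 bᵀ)⁻¹`. -/
def symbol (ζ : ℂ) : Matrix (Fin (m + 1)) (Fin (m + 1)) ℂ :=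
  (R.AC + (ζ / (1 - ζ)) • Matrix.vecMulVec (fun _ => 1) R.bC)⁻¹

/-- `E_n(z)`: the `n`-th Taylor coefficient at `ζ = 0` of the matrix function
`(Δ(ζ) - z I)⁻¹ = ∑ E_n(z) ζⁿ`, taken entrywise. -/
def E (n : ℕ) (z : ℂ) : Matrix (Fin (m + 1)) (Fin (m + 1)) ℂ :=
  Matrix.of fun i k => iteratedDeriv n (fun ζ : ℂ => (R.symbol ζ - z • 1)⁻¹ i k) 0 / (n.factorial : ℂ)

/-- `e_n(z)`: the last row of `E_n(z)`. -/
def e (n : ℕ) (z : ℂ) : Fin (m + 1) → ℂ := R.E n z (Fin.last m)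

/-- The assumptions on the Runge-Kutta method. -/
structure Admissible : Prop where
  /-- A-stability, first half: the stage equations are solvable in the closed left half-plane. -/
  isUnit_of_re_nonpos : ∀ z : ℂ, z.re ≤ 0 → IsUnit (1 - z • R.AC)
  /-- A-stability, second half. -/
  norm_stab_le : ∀ z : ℂ, z.re ≤ 0 → ‖R.stab z‖ ≤ 1
  /-- The classical order is at least one. -/
  sum_b : ∑ i, R.b i = 1
  norm_stab_imag_lt : ∀ y : ℝ, y ≠ 0 → ‖R.stab (Complex.I * y)‖ < 1
  isUnit_A : IsUnit R.A
  /-- Stiff accuracy, `bᵀ A⁻¹ = (0, …, 0, 1)`. -/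
  stiffly_accurate : Matrix.vecMul R.b R.A⁻¹ = Pi.single (Fin.last m) 1

/-- `γ(ξ) = inf { log |r(z)| / Re z : -ξ ≤ Re z < 0 }`. Zeros of `r`, where the quotient is `+∞`,
do not contribute to the infimum and are left out. -/
def gamma (ξ : ℝ) : ℝ :=
  sInf {t : ℝ | ∃ z : ℂ, -ξ ≤ z.re ∧ z.re < 0 ∧ R.stab z ≠ 0 ∧ t = Real.log ‖R.stab z‖ / z.re}

/-- The set of values `‖q(z)‖`, `Re z ≤ 0`, for the norm `N` on row vectors. -/
def qNorms (N : Seminorm ℂ (Fin (m + 1) → ℂ)) : Set ℝ :=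
  (fun z : ℂ => N (R.q z)) '' {z : ℂ | z.re ≤ 0}

end RungeKutta

/-! ### The kernel and the integrals `I_{n,j}` in one space dimension -/

/-- `K(λ e^{i phi}, x) = exp(-|x| s) / (2 s)`, where `s = e^{-iπ/4} √λ e^{i phi/2}` is the value of
`√(z / i)` at `z = λ e^{i phi}`. For `|phi| < π` this is the principal branch, for `phi = ± π` its
continuation onto the two sides of the cut `(-∞, 0]`. -/
def kernelPolar (lam phi x : ℝ) : ℂ :=
  let s : ℂ := Complex.exp (-(Real.pi / 4) * Complex.I) * (Real.sqrt lam : ℂ) *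
    Complex.exp (phi / 2 * Complex.I)
  1 / (2 * s) * Complex.exp (-(|x| : ℝ) * s)

/-- The jump `G(λ, x) = K(λ e^{-iπ}, x) - K(λ e^{iπ}, x)`. -/
def G (lam x : ℝ) : ℂ := kernelPolar lam (-Real.pi) x - kernelPolar lam Real.pi x

/-- The endpoints `L_j`, with `L_j = (1 + B) L_{j-1}` for `j ≥ 1`. -/
def endpoint (B L₀ : ℝ) : ℕ → ℝ
  | 0 => L₀
  | j + 1 => (1 + B) * endpoint B L₀ j

/-- The integrand `h / (2 π i) G(λ, x) e_n(-h λ)`. -/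
def integrand {m : ℕ} (R : RungeKutta m) (h x : ℝ) (n : ℕ) (lam : ℝ) : Fin (m + 1) → ℂ :=
  ((h : ℂ) / (2 * Real.pi * Complex.I) * G lam x) • R.e n (-(h * lam : ℝ))

/-- The error on `[a, b]` of the Gauss-Legendre rule, carried over from `[-1, 1]` by the affine map
`y ↦ a + (b - a) / 2 * (y + 1)`. -/
def gaussError {m Q : ℕ} (g : GaussLegendreRule Q) (F : ℝ → Fin (m + 1) → ℂ) (a b : ℝ) :
    Fin (m + 1) → ℂ :=
  (∫ lam in a..b, F lam) -
    ∑ k, ((((b - a) / 2 * g.weight k : ℝ)) : ℂ) • F (a + (b - a) / 2 * (g.node k + 1))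

/-- The error `τ_{n,j}(Q)` in the approximation of `I_{n,j}`, `j ≥ 1`, by `Q`-node Gauss
quadrature. -/
def tau {m Q : ℕ} (R : RungeKutta m) (g : GaussLegendreRule Q) (h x B L₀ : ℝ) (n j : ℕ) :
    Fin (m + 1) → ℂ :=
  gaussError g (integrand R h x n) (endpoint B L₀ (j - 1)) (endpoint B L₀ j)

/-! ### The quantities in the bound -/

def rhoMax (B : ℝ) : ℝ := 1 + 2 / B * (1 + Real.sqrt (1 + B))

def etaPlus (B ρ : ℝ) : ℝ := 1 + B * ((ρ + ρ⁻¹) + 2) / 4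

def etaMinus (B ρ : ℝ) : ℝ := 1 + B * (-(ρ + ρ⁻¹) + 2) / 4

/-- The function of `ρ` that is minimized; `L` stands for `L_{j-1}`, `d` for `|x|`, `t` for `t_n`. -/
def boundFun {m : ℕ} (R : RungeKutta m) (Q : ℕ) (h d t B L ρ : ℝ) : ℝ :=
  ρ ^ (-2 * (Q : ℤ) + 1) / (ρ - 1) * (etaMinus B ρ) ^ (-(1 / 2) : ℝ) *
    Real.exp (d * L ^ (1 / 2 : ℝ) * (1 + (ρ / 2) ^ 2) ^ (1 / 4 : ℝ) * (etaPlus B ρ) ^ (1 / 2 : ℝ)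
      - L * t * R.gamma (h * L * etaPlus B ρ) * etaMinus B ρ)

end SchrodingerCQ

end

/-!
Gauss weights are nonnegative with sum at most `2`, so the error of the rule is at most four times
the error of the best uniform approximation by polynomials of degree `< 2Q`. For a function
holomorphic and bounded by `M` on the Bernstein ellipse with parameter `ρ`, truncating the Chebyshev
series bounds the latter by `2 M ρ ^ (-2Q + 1) / (ρ - 1)`; linear functionals dominated by the
seminorm extend the estimate to vector-valued functions.

The ellipse transplanted to `[L, (1 + B) L]` lies in the strip `L η₋ ≤ Re λ ≤ L η₊`, where
`e_n = rⁿ q` makes the integrand holomorphic. There `q` is bounded because it is continuous on the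
left half-plane and tends to `0` at infinity, `|rⁿ|` is bounded through `γ`, and the kernel through
`|√λ|`. The minimum over `ρ` exists because `γ` is upper semicontinuous, so that the bound is lower
semicontinuous, and because the bound blows up at both ends of the interval `(1, ϱ_max)`.
-/

open Filter Topology Bornology
open scoped Matrix

namespace SchrodingerCQ

/-! ### Positivity of the Gauss weights and polynomial approximation -/

namespace GaussLegendreRule

variable {Q : ℕ} (g : GaussLegendreRule Q)

theorem weight_nonneg (k : Fin Q) : 0 ≤ g.weight k := by
  set ℓ := Lagrange.basis Finset.univ g.node k
  have hinj : Set.InjOn g.node (Finset.univ : Finset (Fin Q)) := g.node_injective.injOn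
  have hdeg : (ℓ * ℓ).natDegree < 2 * Q := by
    have hℓ : ℓ.natDegree = Q - 1 := Polynomial.natDegree_eq_of_degree_eq_some (by
      rw [Lagrange.degree_basis hinj (Finset.mem_univ k), Finset.card_univ, Fintype.card_fin])
    have := Polynomial.natDegree_mul_le (p := ℓ) (q := ℓ)
    have := k.pos
    omega
  have hweight : ∑ i, g.weight i * (ℓ * ℓ).eval (g.node i) = g.weight k := by
    rw [Finset.sum_eq_single_of_mem k (Finset.mem_univ k) fun i _ hi => ?_, Polynomial.eval_mul,
      Lagrange.eval_basis_self hinj (Finset.mem_univ k), mul_one, mul_one]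
    rw [Polynomial.eval_mul, Lagrange.eval_basis_of_ne hi.symm (Finset.mem_univ i), mul_zero,
      mul_zero]
  rw [← hweight, g.exact _ hdeg]
  refine intervalIntegral.integral_nonneg (by norm_num) fun x _ => ?_
  rw [Polynomial.eval_mul]
  exact mul_self_nonneg _

theorem sum_weight_le_two : ∑ k, g.weight k ≤ 2 := by
  rcases Nat.eq_zero_or_pos Q with rfl | hQ
  · simp
  · have h := g.exact 1 (by rw [Polynomial.natDegree_one]; omega)
    simp only [Polynomial.eval_one, mul_one, intervalIntegral.integral_const, smul_eq_mul] at h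
    linarith

theorem sum_weight_mul_eval {p : ℂ[X]} (hp : p.degree < (2 * Q : ℕ)) :
    ∑ k, (g.weight k : ℂ) * p.eval (g.node k : ℂ) = ∫ x in (-1 : ℝ)..1, p.eval (x : ℂ) := by
  have hmonomial : ∀ n ∈ p.support,
      ∑ k, (g.weight k : ℂ) * (g.node k : ℂ) ^ n = ∫ x in (-1 : ℝ)..1, (x : ℂ) ^ n := by
    intro n hn
    have hlt : n < 2 * Q := by
      exact_mod_cast (Polynomial.le_degree_of_mem_supp n hn).trans_lt hp
    have h := g.exact (Polynomial.X ^ n) (by rwa [Polynomial.natDegree_X_pow])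
    simp only [Polynomial.eval_pow, Polynomial.eval_X] at h
    simp only [← Complex.ofReal_pow, intervalIntegral.integral_ofReal, ← h]
    push_cast
    rfl
  simp only [Polynomial.eval_eq_sum, Polynomial.sum, Finset.mul_sum]
  rw [Finset.sum_comm, intervalIntegral.integral_finsetSum fun n _ =>
    Continuous.intervalIntegrable (by fun_prop) _ _]
  refine Finset.sum_congr rfl fun n hn => ?_
  rw [intervalIntegral.integral_const_mul, ← hmonomial n hn, Finset.mul_sum]
  exact Finset.sum_congr rfl fun k _ => mul_left_comm _ _ _

theorem norm_error_le_of_approx {φ : ℝ → ℂ} (hφ : ContinuousOn φ (Set.Icc (-1) 1)) {p : ℂ[X]}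
    (hp : p.degree < (2 * Q : ℕ)) {ε : ℝ}
    (hε : ∀ x ∈ Set.Icc (-1 : ℝ) 1, ‖φ x - p.eval (x : ℂ)‖ ≤ ε) :
    ‖(∫ x in (-1 : ℝ)..1, φ x) - ∑ k, (g.weight k : ℂ) * φ (g.node k)‖ ≤ 4 * ε := by
  have hε0 : 0 ≤ ε := (norm_nonneg _).trans (hε 0 (by norm_num))
  have hsplit : (∫ x in (-1 : ℝ)..1, φ x) - ∑ k, (g.weight k : ℂ) * φ (g.node k) =
      (∫ x in (-1 : ℝ)..1, (φ x - p.eval (x : ℂ))) -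
        ∑ k, (g.weight k : ℂ) * (φ (g.node k) - p.eval (g.node k : ℂ)) := by
    rw [intervalIntegral.integral_sub
      (ContinuousOn.intervalIntegrable (by rwa [Set.uIcc_of_le (by norm_num)]))
      (Continuous.intervalIntegrable (by fun_prop) _ _), ← g.sum_weight_mul_eval hp]
    simp only [mul_sub, Finset.sum_sub_distrib]
    ring
  have hintegral : ‖∫ x in (-1 : ℝ)..1, (φ x - p.eval (x : ℂ))‖ ≤ 2 * ε := by
    refine (intervalIntegral.norm_integral_le_of_norm_le_const (C := ε) fun x hx => ?_).trans_eq
      (by norm_num [mul_comm])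
    rw [Set.uIoc_of_le (by norm_num)] at hx
    exact hε x ⟨hx.1.le, hx.2⟩
  have hsum : ‖∑ k, (g.weight k : ℂ) * (φ (g.node k) - p.eval (g.node k : ℂ))‖ ≤ 2 * ε := by
    refine le_trans ?_ (mul_le_mul_of_nonneg_right g.sum_weight_le_two hε0)
    rw [Finset.sum_mul]
    refine norm_sum_le_of_le _ fun k _ => ?_
    rw [norm_mul, Complex.norm_real, Real.norm_of_nonneg (g.weight_nonneg k)]
    exact mul_le_mul_of_nonneg_left (hε _ (g.node_mem k)) (g.weight_nonneg k)
  rw [hsplit]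
  linarith [norm_sub_le (∫ x in (-1 : ℝ)..1, (φ x - p.eval (x : ℂ)))
    (∑ k, (g.weight k : ℂ) * (φ (g.node k) - p.eval (g.node k : ℂ)))]

end GaussLegendreRule

/-! ### Chebyshev expansion on a Bernstein ellipse -/

/-- The Joukowski map, which sends the circles `‖u‖ = ρ` to the ellipses with foci `±1`. -/
noncomputable def joukowski (u : ℂ) : ℂ := (u + u⁻¹) / 2

theorem joukowski_inv (u : ℂ) : joukowski u⁻¹ = joukowski u := by
  simp only [joukowski, inv_inv, add_comm]

theorem joukowski_exp_mul_I (θ : ℝ) :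
    joukowski (Complex.exp (θ * Complex.I)) = (Real.cos θ : ℝ) := by
  rw [joukowski, ← Complex.exp_neg, Complex.ofReal_cos, Complex.cos, neg_mul]

theorem differentiableAt_joukowski {u : ℂ} (hu : u ≠ 0) : DifferentiableAt ℂ joukowski u :=
  (differentiableAt_id.add (differentiableAt_inv hu)).div_const 2

/-- The closed region bounded by the Bernstein ellipse with parameter `ρ`, whose foci are `±1` and
whose semiaxes add up to `ρ`. -/
def bernsteinEllipse (ρ : ℝ) : Set ℂ := joukowski '' {u | ‖u‖ ∈ Set.Icc 1 ρ}

theorem joukowski_mem_bernsteinEllipse {ρ : ℝ} {u : ℂ} (h1 : 1 ≤ ‖u‖) (h2 : ‖u‖ ≤ ρ) :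
    joukowski u ∈ bernsteinEllipse ρ :=
  ⟨u, ⟨h1, h2⟩, rfl⟩

theorem ofReal_mem_bernsteinEllipse {ρ x : ℝ} (hρ : 1 ≤ ρ) (hx : x ∈ Set.Icc (-1 : ℝ) 1) :
    (x : ℂ) ∈ bernsteinEllipse ρ := by
  refine ⟨Complex.exp (Real.arccos x * Complex.I), ?_, ?_⟩
  · rw [Set.mem_ofPred_eq, Complex.norm_exp_ofReal_mul_I]
    exact ⟨le_rfl, hρ⟩
  · rw [joukowski_exp_mul_I, Real.cos_arccos hx.1 hx.2]

section Fourier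

variable {T : ℝ}

theorem fourier_add_fourier_neg (n : ℤ) (θ : ℝ) :
    (fourier n (θ : AddCircle T) : ℂ) + fourier (-n) (θ : AddCircle T) =
      2 * (Real.cos (2 * Real.pi * n * θ / T) : ℝ) := by
  rw [fourier_coe_apply, fourier_coe_apply, Complex.ofReal_cos, Complex.two_cos]
  push_cast
  congr 2 <;> ring

variable [Fact (0 < T)]

theorem fourierCoeff_neg_of_even {E : Type*} [NormedAddCommGroup E] [NormedSpace ℂ E]
    {F : AddCircle T → E} (hF : F.Even) (n : ℤ) : fourierCoeff F (-n) = fourierCoeff F n := by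
  unfold fourierCoeff
  rw [← MeasureTheory.integral_neg_eq_self]
  refine MeasureTheory.integral_congr_ae (Filter.Eventually.of_forall fun x => ?_)
  simp only [fourier_apply, hF x, neg_neg, smul_neg, neg_smul]

theorem hasSum_cos_of_even {F : C(AddCircle T, ℂ)} (hF : Function.Even F)
    (hsum : Summable (fourierCoeff F)) (θ : ℝ) :
    HasSum (fun k : ℕ => (if k = 0 then 1 else 2) * fourierCoeff F k *
      (Real.cos (2 * Real.pi * k * θ / T) : ℝ)) (F θ) := by
  have hpairs := (has_pointwise_sum_fourier_series_of_summable hsum θ).nat_add_neg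
  have hzero : HasSum (fun k : ℕ => if k = 0 then fourierCoeff F 0 else 0) (fourierCoeff F 0) :=
    hasSum_ite_eq 0 _
  have hterm : ∀ k : ℕ, fourierCoeff F k • fourier k (θ : AddCircle T) +
      fourierCoeff F (-k) • fourier (-k) (θ : AddCircle T) -
        (if k = 0 then fourierCoeff F 0 else 0) =
      (if k = 0 then 1 else 2) * fourierCoeff F k *
        (Real.cos (2 * Real.pi * k * θ / T) : ℝ) := fun k => by
    rw [fourierCoeff_neg_of_even hF, ← smul_add, fourier_add_fourier_neg, smul_eq_mul]
    split_ifs with hk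
    · subst hk
      simp only [Nat.cast_zero, mul_zero, zero_mul, zero_div, Real.cos_zero, Complex.ofReal_one,
        Int.cast_zero]
      ring
    · push_cast
      ring
  have hdiff := hpairs.sub hzero
  simp only [hterm] at hdiff
  rwa [fourier_zero, smul_eq_mul, mul_one, add_sub_cancel_right] at hdiff

end Fourier

section Chebyshev

variable {f : ℂ → ℂ} {ρ M : ℝ}

local instance fact_zero_lt_two_pi : Fact (0 < 2 * Real.pi) := ⟨Real.two_pi_pos⟩

theorem toCircle_coe_eq_exp (θ : ℝ) :
    (AddCircle.toCircle (θ : AddCircle (2 * Real.pi)) : ℂ) = Complex.exp (θ * Complex.I) := by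
  rw [AddCircle.toCircle_apply_mk, Circle.coe_exp, div_self Real.two_pi_pos.ne', one_mul]

theorem fourierCoeff_comp_toCircle (g : ℂ → ℂ) (k : ℤ) :
    fourierCoeff (fun x : AddCircle (2 * Real.pi) => g x.toCircle) k =
      (2 * Real.pi * Complex.I)⁻¹ * ∮ u in C(0, 1), u⁻¹ • (u ^ (-k) * g u) := by
  have hintegral : (∮ u in C(0, 1), u⁻¹ • (u ^ (-k) * g u)) = Complex.I *
      ∫ θ in (0 : ℝ)..2 * Real.pi, (fourier (-k) (θ : AddCircle (2 * Real.pi)) : ℂ) •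
        g (AddCircle.toCircle (θ : AddCircle (2 * Real.pi))) := by
    rw [circleIntegral, ← intervalIntegral.integral_const_mul]
    refine intervalIntegral.integral_congr fun θ _ => ?_
    simp only [fourier_apply, AddCircle.toCircle_zsmul, Circle.coe_zpow, toCircle_coe_eq_exp,
      deriv_circleMap, circleMap_zero, Complex.ofReal_one, one_mul, smul_eq_mul]
    field_simp [Complex.exp_ne_zero (θ * Complex.I)]
  rw [hintegral, fourierCoeff_eq_intervalIntegral _ k 0, zero_add, Complex.real_smul]
  push_cast
  field_simp

theorem norm_fourierCoeff_comp_toCircle_le {g : ℂ → ℂ} (hρ : 1 ≤ ρ)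
    (hg : ∀ u : ℂ, 1 ≤ ‖u‖ → ‖u‖ ≤ ρ → DifferentiableAt ℂ g u)
    (hM : ∀ u : ℂ, ‖u‖ = ρ → ‖g u‖ ≤ M) (k : ℤ) :
    ‖fourierCoeff (fun x : AddCircle (2 * Real.pi) => g x.toCircle) k‖ ≤ M * ρ ^ (-k) := by
  have hρ0 : 0 < ρ := by linarith
  have hdiff : ∀ u : ℂ, 1 ≤ ‖u‖ → ‖u‖ ≤ ρ →
      DifferentiableAt ℂ (fun u : ℂ => u ^ (-k) * g u) u := fun u h1 h2 =>
    (differentiableAt_zpow.2 (.inl (norm_pos_iff.1 (one_pos.trans_le h1)))).mul (hg u h1 h2)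
  have hdeform :=
    Complex.circleIntegral_sub_center_inv_smul_eq_of_differentiable_on_annulus_off_countable
      (c := 0) one_pos hρ (f := fun u : ℂ => u ^ (-k) * g u) Set.countable_empty
      (fun u hu => (hdiff u (by simpa using hu.2)
        (by simpa using hu.1)).continuousAt.continuousWithinAt)
      (fun u hu => hdiff u (by simpa using (not_le.1 (by simpa using hu.1.2)).le)
        (by simpa using (mem_ball_zero_iff.1 hu.1.1).le))
  simp only [sub_zero] at hdeform
  have hbound : ‖∮ u in C(0, ρ), u⁻¹ • (u ^ (-k) * g u)‖ ≤
      2 * Real.pi * ρ * (ρ⁻¹ * (ρ ^ (-k) * M)) := by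
    refine circleIntegral.norm_integral_le_of_norm_le_const hρ0.le fun u hu => ?_
    have hu' : ‖u‖ = ρ := by simpa using hu
    rw [smul_eq_mul, norm_mul, norm_mul, norm_inv, norm_zpow, hu']
    gcongr
    exact hM u hu'
  rw [fourierCoeff_comp_toCircle, ← hdeform, norm_mul]
  refine (mul_le_mul_of_nonneg_left hbound (norm_nonneg _)).trans_eq ?_
  simp only [norm_inv, norm_mul, Complex.norm_I, Complex.norm_real, Complex.norm_ofNat,
    Real.norm_of_nonneg Real.pi_pos.le]
  field_simp

theorem summable_fourierCoeff_comp_toCircle_of_even {F : AddCircle (2 * Real.pi) → ℂ}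
    (hF : F.Even) (hρ : 1 < ρ) (hcoeff : ∀ k : ℤ, ‖fourierCoeff F k‖ ≤ M * ρ ^ (-k)) :
    Summable (fourierCoeff F) := by
  have hgeom : Summable fun k : ℕ => M * ρ ^ (-(k : ℤ)) := by
    simp only [zpow_neg, zpow_natCast, ← inv_pow]
    exact (summable_geometric_of_lt_one (by positivity) (inv_lt_one_of_one_lt₀ hρ)).mul_left M
  refine Summable.of_nat_of_neg (.of_norm_bounded hgeom fun k => hcoeff k)
    (.of_norm_bounded hgeom fun k => ?_)
  rw [fourierCoeff_neg_of_even hF]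
  exact hcoeff k

theorem continuous_comp_joukowski_toCircle (hρ : 1 ≤ ρ)
    (hf : ∀ w ∈ bernsteinEllipse ρ, ContinuousAt f w) :
    Continuous fun x : AddCircle (2 * Real.pi) => f (joukowski x.toCircle) := by
  refine continuous_iff_continuousAt.2 fun x => ?_
  have hmem : joukowski x.toCircle ∈ bernsteinEllipse ρ :=
    joukowski_mem_bernsteinEllipse (Circle.norm_coe _).ge ((Circle.norm_coe _).trans_le hρ)
  have hjoukowski : ContinuousAt joukowski x.toCircle :=
    (differentiableAt_joukowski (Circle.coe_ne_zero _)).continuousAt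
  exact ContinuousAt.comp' (hf _ hmem) (ContinuousAt.comp' hjoukowski
    (continuous_subtype_val.comp AddCircle.continuous_toCircle).continuousAt)

theorem exists_chebyshev_expansion (hρ : 1 < ρ)
    (hf : ∀ w ∈ bernsteinEllipse ρ, DifferentiableAt ℂ f w)
    (hM : ∀ w ∈ bernsteinEllipse ρ, ‖f w‖ ≤ M) :
    ∃ a : ℕ → ℂ, (∀ k, ‖a k‖ ≤ 2 * M * ρ ^ (-(k : ℤ))) ∧ ∀ x ∈ Set.Icc (-1 : ℝ) 1,
      HasSum (fun k : ℕ => a k * (Polynomial.Chebyshev.T ℂ k).eval (x : ℂ)) (f x) := by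
  let F : C(AddCircle (2 * Real.pi), ℂ) :=
    ⟨fun x => f (joukowski x.toCircle),
      continuous_comp_joukowski_toCircle hρ.le fun w hw => (hf w hw).continuousAt⟩
  have hcoeff : ∀ k : ℤ, ‖fourierCoeff F k‖ ≤ M * ρ ^ (-k) :=
    norm_fourierCoeff_comp_toCircle_le (g := f ∘ joukowski) hρ.le
      (fun u h1 h2 => (hf _ (joukowski_mem_bernsteinEllipse h1 h2)).comp u
        (differentiableAt_joukowski (norm_pos_iff.1 (one_pos.trans_le h1))))
      (fun u hu => hM _ (joukowski_mem_bernsteinEllipse (hρ.le.trans_eq hu.symm) hu.le))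
  have heven : Function.Even F := fun x => congrArg f (by
    rw [AddCircle.toCircle_neg, Circle.coe_inv, joukowski_inv])
  refine ⟨fun k => (if k = 0 then 1 else 2) * fourierCoeff F k, fun k => ?_, fun x hx => ?_⟩
  · rw [norm_mul, mul_assoc]
    refine mul_le_mul ?_ (hcoeff k) (norm_nonneg _) zero_le_two
    split_ifs <;> norm_num
  · have h := hasSum_cos_of_even heven
      (summable_fourierCoeff_comp_toCircle_of_even heven hρ hcoeff) (Real.arccos x)
    have hT : ∀ k : ℕ, (Polynomial.Chebyshev.T ℂ k).eval (x : ℂ) =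
        (Real.cos (2 * Real.pi * k * Real.arccos x / (2 * Real.pi)) : ℝ) := fun k => by
      rw [mul_assoc, mul_div_cancel_left₀ _ Real.two_pi_pos.ne', Complex.ofReal_cos]
      conv_lhs => rw [← Real.cos_arccos hx.1 hx.2, Complex.ofReal_cos]
      rw [Polynomial.Chebyshev.T_complex_cos]
      push_cast
      rfl
    have hF : F (Real.arccos x) = f x := by
      change f (joukowski _) = _
      rw [toCircle_coe_eq_exp, joukowski_exp_mul_I, Real.cos_arccos hx.1 hx.2]
    simp only [hT]
    rwa [hF] at h

end Chebyshev

theorem norm_eval_chebyshev_T_le_one (k : ℤ) {x : ℝ} (hx : x ∈ Set.Icc (-1 : ℝ) 1) :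
    ‖(Polynomial.Chebyshev.T ℂ k).eval (x : ℂ)‖ ≤ 1 := by
  rw [← Polynomial.Chebyshev.complex_ofReal_eval_T, Complex.norm_real, Real.norm_eq_abs]
  exact Polynomial.Chebyshev.abs_eval_T_real_le_one k (abs_le.2 hx)

theorem hasSum_zpow_neg_tail {ρ : ℝ} (hρ : 1 < ρ) (n : ℕ) :
    HasSum (fun k : ℕ => ρ ^ (-((k + n : ℕ) : ℤ))) (ρ ^ (-(n : ℤ) + 1) / (ρ - 1)) := by
  have hρ0 : ρ ≠ 0 := by positivity
  have hρ1 : ρ - 1 ≠ 0 := (sub_pos.2 hρ).ne'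
  have hgeom := (hasSum_geometric_of_lt_one (by positivity)
    (inv_lt_one_of_one_lt₀ hρ)).mul_left (ρ ^ (-(n : ℤ)))
  have hvalue : ρ ^ (-(n : ℤ)) * (1 - ρ⁻¹)⁻¹ = ρ ^ (-(n : ℤ) + 1) / (ρ - 1) := by
    rw [zpow_add₀ hρ0, zpow_one]
    field_simp
  have hterm : ∀ k : ℕ, ρ ^ (-(n : ℤ)) * ρ⁻¹ ^ k = ρ ^ (-((k + n : ℕ) : ℤ)) := fun k => by
    rw [Nat.cast_add, neg_add_rev, zpow_add₀ hρ0, zpow_neg ρ k, zpow_natCast, inv_pow]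
  simpa only [hterm, hvalue] using hgeom

theorem exists_polynomial_norm_sub_le {f : ℂ → ℂ} {ρ M : ℝ} (hρ : 1 < ρ)
    (hf : ∀ w ∈ bernsteinEllipse ρ, DifferentiableAt ℂ f w)
    (hM : ∀ w ∈ bernsteinEllipse ρ, ‖f w‖ ≤ M) (n : ℕ) :
    ∃ p : ℂ[X], p.degree < n ∧ ∀ x ∈ Set.Icc (-1 : ℝ) 1,
      ‖f x - p.eval (x : ℂ)‖ ≤ 2 * M * (ρ ^ (-(n : ℤ) + 1) / (ρ - 1)) := by
  obtain ⟨a, ha, hsum⟩ := exists_chebyshev_expansion hρ hf hM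
  refine ⟨∑ k ∈ Finset.range n, a k • Polynomial.Chebyshev.T ℂ k, ?_, fun x hx => ?_⟩
  · refine Polynomial.mem_degreeLT.1 (Submodule.sum_mem _ fun k hk =>
      Submodule.smul_mem _ _ (Polynomial.mem_degreeLT.2 ?_))
    rw [Polynomial.Chebyshev.degree_T, Int.natAbs_natCast]
    exact_mod_cast Finset.mem_range.1 hk
  · simp only [Polynomial.eval_finsetSum, Polynomial.eval_smul, smul_eq_mul]
    refine ((hasSum_nat_add_iff' n).2 (hsum x hx)).norm_le_of_bounded
      ((hasSum_zpow_neg_tail hρ n).mul_left (2 * M)) fun k => ?_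
    rw [norm_mul]
    exact (mul_le_of_le_one_right (norm_nonneg _) (norm_eval_chebyshev_T_le_one _ hx)).trans (ha _)

theorem continuousOn_Icc_of_continuousAt_bernsteinEllipse {E : Type*} [TopologicalSpace E]
    {f : ℂ → E} {ρ : ℝ} (hρ : 1 ≤ ρ) (hf : ∀ w ∈ bernsteinEllipse ρ, ContinuousAt f w) :
    ContinuousOn (fun x : ℝ => f x) (Set.Icc (-1) 1) := fun x hx =>
  (ContinuousAt.comp' (hf x (ofReal_mem_bernsteinEllipse hρ hx))
    Complex.continuous_ofReal.continuousAt).continuousWithinAt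

theorem GaussLegendreRule.norm_error_le {Q : ℕ} (g : GaussLegendreRule Q) {f : ℂ → ℂ} {ρ M : ℝ}
    (hρ : 1 < ρ) (hf : ∀ w ∈ bernsteinEllipse ρ, DifferentiableAt ℂ f w)
    (hM : ∀ w ∈ bernsteinEllipse ρ, ‖f w‖ ≤ M) :
    ‖(∫ x in (-1 : ℝ)..1, f x) - ∑ k, (g.weight k : ℂ) * f (g.node k)‖ ≤
      8 * M * (ρ ^ (-2 * (Q : ℤ) + 1) / (ρ - 1)) := by
  obtain ⟨p, hp, happrox⟩ := exists_polynomial_norm_sub_le hρ hf hM (2 * Q)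
  refine (g.norm_error_le_of_approx (continuousOn_Icc_of_continuousAt_bernsteinEllipse hρ.le
    fun w hw => (hf w hw).continuousAt) hp happrox).trans_eq ?_
  push_cast
  ring_nf

theorem exists_dual_eq_seminorm {E : Type*} [AddCommGroup E] [Module ℂ E] (N : Seminorm ℂ E)
    (v : E) : ∃ φ : Module.Dual ℂ E, φ v = N v ∧ ∀ w, ‖φ w‖ ≤ N w := by
  rcases eq_or_ne v 0 with rfl | hv
  · exact ⟨0, by simp, fun w => by simp⟩
  let coord : Module.Dual ℂ (ℂ ∙ v) := (LinearEquiv.coord ℂ E v hv).toLinearMap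
  obtain ⟨φ, hext, hle⟩ := Module.Dual.exists_extension_of_le_seminorm (ℂ ∙ v)
    ((N v : ℂ) • coord) (p := N) (fun x => by
      rw [LinearMap.smul_apply, smul_eq_mul, norm_mul, Complex.norm_real,
        Real.norm_of_nonneg (apply_nonneg N v), mul_comm]
      conv_rhs => rw [← LinearEquiv.coord_apply_smul ℂ E v hv x, map_smul_eq_mul]
      rfl)
  refine ⟨φ, ?_, hle⟩
  have hcoord : coord ⟨v, Submodule.mem_span_singleton_self v⟩ = 1 :=
    LinearEquiv.coord_self ℂ E v hv
  simpa only [LinearMap.smul_apply, hcoord, smul_eq_mul, mul_one] using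
    hext ⟨v, Submodule.mem_span_singleton_self v⟩

theorem GaussLegendreRule.seminorm_error_le {E : Type*} [NormedAddCommGroup E] [NormedSpace ℂ E]
    [FiniteDimensional ℂ E] (N : Seminorm ℂ E) {Q : ℕ} (g : GaussLegendreRule Q) {f : ℂ → E}
    {ρ M : ℝ} (hρ : 1 < ρ) (hf : ∀ w ∈ bernsteinEllipse ρ, DifferentiableAt ℂ f w)
    (hM : ∀ w ∈ bernsteinEllipse ρ, N (f w) ≤ M) :
    N ((∫ x in (-1 : ℝ)..1, f x) - ∑ k, (g.weight k : ℂ) • f (g.node k)) ≤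
      8 * M * (ρ ^ (-2 * (Q : ℤ) + 1) / (ρ - 1)) := by
  obtain ⟨φ, hφ, hle⟩ := exists_dual_eq_seminorm N
    ((∫ x in (-1 : ℝ)..1, f x) - ∑ k, (g.weight k : ℂ) • f (g.node k))
  have : CompleteSpace E := FiniteDimensional.complete ℂ E
  let φL : E →L[ℂ] ℂ := LinearMap.toContinuousLinearMap φ
  have hintegrable : IntervalIntegrable (fun x : ℝ => f x) MeasureTheory.volume (-1) 1 := by
    refine ContinuousOn.intervalIntegrable ?_
    rw [Set.uIcc_of_le (by norm_num)]
    exact continuousOn_Icc_of_continuousAt_bernsteinEllipse hρ.le fun w hw =>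
      (hf w hw).continuousAt
  have happly : φ ((∫ x in (-1 : ℝ)..1, f x) - ∑ k, (g.weight k : ℂ) • f (g.node k)) =
      (∫ x in (-1 : ℝ)..1, φL (f x)) - ∑ k, (g.weight k : ℂ) * φL (f (g.node k)) := by
    rw [φL.intervalIntegral_comp_comm hintegrable, map_sub, map_sum]
    simp only [map_smul, smul_eq_mul]
    rfl
  have herror := g.norm_error_le (f := fun w => φL (f w)) hρ
    (fun w hw => φL.differentiableAt.comp w (hf w hw)) fun w hw => (hle _).trans (hM w hw)
  rwa [← happly, hφ, Complex.norm_real, Real.norm_of_nonneg (apply_nonneg N _)] at herror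

/-- The affine map that carries the quadrature rules over from `[-1, 1]` to `[a, b]`, on `ℂ`. -/
noncomputable def transplant (a b : ℝ) (w : ℂ) : ℂ := a + (b - a) / 2 * (w + 1)

theorem transplant_ofReal (a b y : ℝ) :
    transplant a b y = (a + (b - a) / 2 * (y + 1) : ℝ) := by
  rw [transplant]
  push_cast
  rfl

theorem differentiable_transplant (a b : ℝ) : Differentiable ℂ (transplant a b) := by
  unfold transplant
  fun_prop

theorem gaussError_eq_smul {m Q : ℕ} (g : GaussLegendreRule Q) (F : ℝ → Fin (m + 1) → ℂ)
    (a b : ℝ) : gaussError g F a b = (((b - a) / 2 : ℝ) : ℂ) •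
      ((∫ y in (-1 : ℝ)..1, F (a + (b - a) / 2 * (y + 1))) -
        ∑ k, (g.weight k : ℂ) • F (a + (b - a) / 2 * (g.node k + 1))) := by
  have hsubst := intervalIntegral.smul_integral_comp_mul_add (a := -1) (b := 1) F
    ((b - a) / 2) (a + (b - a) / 2)
  rw [show (b - a) / 2 * -1 + (a + (b - a) / 2) = a by ring,
    show (b - a) / 2 * 1 + (a + (b - a) / 2) = b by ring] at hsubst
  rw [gaussError, smul_sub, Finset.smul_sum, Complex.coe_smul, ← hsubst]
  congr 1
  · congr! 4
    ring
  · refine Finset.sum_congr rfl fun k _ => ?_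
    rw [smul_smul, Complex.ofReal_mul]

theorem seminorm_gaussError_le {m Q : ℕ} (N : Seminorm ℂ (Fin (m + 1) → ℂ))
    (g : GaussLegendreRule Q) {Φ : ℂ → Fin (m + 1) → ℂ} {F : ℝ → Fin (m + 1) → ℂ}
    {a b ρ M : ℝ} (hab : a ≤ b) (hρ : 1 < ρ) (hF : ∀ x ∈ Set.Icc a b, F x = Φ x)
    (hΦ : ∀ w ∈ bernsteinEllipse ρ, DifferentiableAt ℂ Φ (transplant a b w))
    (hM : ∀ w ∈ bernsteinEllipse ρ, N (Φ (transplant a b w)) ≤ M) :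
    N (gaussError g F a b) ≤ (b - a) / 2 * (8 * M * (ρ ^ (-2 * (Q : ℤ) + 1) / (ρ - 1))) := by
  have hFΦ : ∀ y ∈ Set.Icc (-1 : ℝ) 1, F (a + (b - a) / 2 * (y + 1)) = Φ (transplant a b y) := by
    rintro y ⟨hy1, hy2⟩
    rw [transplant_ofReal, hF]
    constructor <;> nlinarith
  have hintegral : ∫ y in (-1 : ℝ)..1, F (a + (b - a) / 2 * (y + 1)) =
      ∫ y in (-1 : ℝ)..1, Φ (transplant a b y) :=
    intervalIntegral.integral_congr fun y hy => hFΦ y (by rwa [Set.uIcc_of_le (by norm_num)] at hy)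
  rw [gaussError_eq_smul, map_smul_eq_mul, Complex.norm_real,
    Real.norm_of_nonneg (by linarith), hintegral]
  simp only [hFΦ _ (g.node_mem _)]
  exact mul_le_mul_of_nonneg_left (g.seminorm_error_le N (f := fun w => Φ (transplant a b w)) hρ
    (fun w hw => (hΦ w hw).comp w (differentiable_transplant a b w)) hM) (by linarith)

/-! ### The Runge–Kutta convolution weights -/

section MatrixInverse

open scoped Matrix.Norms.Operator

variable {n : Type*} [Fintype n] [DecidableEq n]

theorem eventually_isUnit_matrix {𝕜 ι : Type*} [NontriviallyNormedField 𝕜] {l : Filter ι}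
    {X : ι → Matrix n n 𝕜} {Y : Matrix n n 𝕜} (hX : Tendsto X l (𝓝 Y)) (hY : IsUnit Y) :
    ∀ᶠ i in l, IsUnit (X i) := by
  simp only [Matrix.isUnit_iff_isUnit_det, isUnit_iff_ne_zero] at hY ⊢
  exact ((continuous_id.matrix_det.tendsto Y).comp hX).eventually_ne hY

theorem differentiableAt_matrix_inv {X : ℂ → Matrix n n ℂ} {z : ℂ}
    (hX : DifferentiableAt ℂ X z) (hunit : IsUnit (X z)) :
    DifferentiableAt ℂ (fun w => (X w)⁻¹) z := by
  simp only [Matrix.nonsing_inv_eq_ringInverse]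
  exact (differentiableAt_inverse hunit).comp z hX

theorem tendsto_matrix_inv {ι : Type*} {l : Filter ι} {X : ι → Matrix n n ℂ} {Y : Matrix n n ℂ}
    (hX : Tendsto X l (𝓝 Y)) (hY : IsUnit Y) : Tendsto (fun i => (X i)⁻¹) l (𝓝 Y⁻¹) := by
  simp only [Matrix.nonsing_inv_eq_ringInverse]
  exact (differentiableAt_inverse (𝕜 := ℂ) hY).continuousAt.tendsto.comp hX

theorem matrix_inv_apply_eq_of_vecMul_eq_single {𝕜 : Type*} [Field 𝕜] {M : Matrix n n 𝕜}
    (hM : IsUnit M) {v : n → 𝕜} {i : n} (hv : v ᵥ* M = Pi.single i 1) : M⁻¹ i = v := by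
  have := congrArg (· ᵥ* M⁻¹) hv
  simp only [Matrix.vecMul_vecMul, Matrix.single_one_vecMul,
    Matrix.mul_nonsing_inv _ ((Matrix.isUnit_iff_isUnit_det M).1 hM), Matrix.vecMul_one] at this
  exact this.symm

end MatrixInverse

theorem iteratedDeriv_div_factorial_of_eventuallyEq_geometric {f : ℂ → ℂ} {r c : ℂ}
    (hf : f =ᶠ[𝓝 0] fun ζ => (1 - ζ * r)⁻¹ * c) (n : ℕ) :
    iteratedDeriv n f 0 / (n.factorial : ℂ) = r ^ n * c := by
  have hsmall : ∀ᶠ ζ : ℂ in 𝓝 0, ‖ζ * r‖ < 1 :=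
    (Continuous.continuousAt (by fun_prop)).eventually_lt continuousAt_const (by simp)
  have hseries : HasFPowerSeriesAt f
      (FormalMultilinearSeries.ofScalars ℂ fun n => r ^ n * c) 0 := by
    rw [hasFPowerSeriesAt_iff]
    filter_upwards [hsmall, hf] with ζ hζ hfζ
    simpa only [zero_add, hfζ, FormalMultilinearSeries.coeff_ofScalars, smul_eq_mul, mul_pow,
      mul_assoc] using (hasSum_geometric_of_norm_lt_one hζ).mul_right c
  have huniq := hseries.analyticAt.hasFPowerSeriesAt.eq_formalMultilinearSeries hseries
  simpa only [FormalMultilinearSeries.coeff_ofScalars] using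
    congrArg (fun p => FormalMultilinearSeries.coeff p n) huniq

namespace RungeKutta

variable {m : ℕ} {R : RungeKutta m}

/-- `A`-stability of a Runge–Kutta method, together with the solvability of its stage equations in
the closed left half-plane. -/
structure AStable (R : RungeKutta m) : Prop where
  isUnit_of_re_nonpos : ∀ z : ℂ, z.re ≤ 0 → IsUnit (1 - z • R.AC)
  norm_stab_le : ∀ z : ℂ, z.re ≤ 0 → ‖R.stab z‖ ≤ 1

/-- Stiff accuracy of a Runge–Kutta method with invertible coefficient matrix, in the form
`bᵀ A⁻¹ = (0, …, 0, 1)`. -/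
structure StifflyAccurate (R : RungeKutta m) : Prop where
  isUnit_A : IsUnit R.A
  vecMul_inv : R.b ᵥ* R.A⁻¹ = Pi.single (Fin.last m) 1

theorem Admissible.aStable (hR : R.Admissible) : R.AStable :=
  ⟨hR.isUnit_of_re_nonpos, hR.norm_stab_le⟩

theorem Admissible.stifflyAccurate (hR : R.Admissible) : R.StifflyAccurate :=
  ⟨hR.isUnit_A, hR.stiffly_accurate⟩

section Resolvent

open scoped Matrix.Norms.Operator

theorem differentiableAt_q {z : ℂ} (hz : IsUnit (1 - z • R.AC)) : DifferentiableAt ℂ R.q z := by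
  have hinv : DifferentiableAt ℂ (fun w : ℂ => (1 - w • R.AC)⁻¹) z :=
    differentiableAt_matrix_inv (by fun_prop) hz
  exact (LinearMap.toContinuousLinearMap
    (Matrix.vecMulBilin ℂ ℂ R.bC)).differentiableAt.comp z hinv

theorem stab_eq (z : ℂ) : R.stab z = 1 + z * (R.q z ⬝ᵥ fun _ => 1) := by
  rw [stab, q, Matrix.dotProduct_mulVec]

theorem stab_zero : R.stab 0 = 1 := by simp [stab]

theorem differentiableAt_stab {z : ℂ} (hz : IsUnit (1 - z • R.AC)) :
    DifferentiableAt ℂ R.stab z := by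
  have hq := differentiableAt_pi.1 (differentiableAt_q hz)
  rw [funext (stab_eq (R := R))]
  simp only [dotProduct, mul_one]
  fun_prop

theorem q_vecMul {z : ℂ} (hz : IsUnit (1 - z • R.AC)) : R.q z ᵥ* (1 - z • R.AC) = R.bC := by
  rw [q, Matrix.vecMul_vecMul, Matrix.nonsing_inv_mul _ ((Matrix.isUnit_iff_isUnit_det _).1 hz),
    Matrix.vecMul_one]

theorem StifflyAccurate.isUnit_AC (hR : R.StifflyAccurate) : IsUnit R.AC :=
  hR.isUnit_A.map (Complex.ofRealHom.mapMatrix : Matrix (Fin (m + 1)) (Fin (m + 1)) ℝ →+* _)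

theorem StifflyAccurate.AC_last (hR : R.StifflyAccurate) : R.AC (Fin.last m) = R.bC := by
  have hA := (Matrix.isUnit_iff_isUnit_det _).1 hR.isUnit_A
  have h := matrix_inv_apply_eq_of_vecMul_eq_single
    (Matrix.isUnit_nonsing_inv_iff.2 hR.isUnit_A) hR.vecMul_inv
  rw [Matrix.nonsing_inv_nonsing_inv _ hA] at h
  funext k
  simp only [AC, bC, Matrix.map_apply, h]

/-- The matrix `Δ(ζ)⁻¹ = A + ζ / (1 - ζ) 𝟙 bᵀ`. -/
noncomputable def symbolInv (R : RungeKutta m) (ζ : ℂ) : Matrix (Fin (m + 1)) (Fin (m + 1)) ℂ :=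
  R.AC + (ζ / (1 - ζ)) • Matrix.vecMulVec (fun _ => 1) R.bC

theorem continuousAt_symbolInv_zero : ContinuousAt R.symbolInv 0 := by
  have : ContinuousAt (fun ζ : ℂ => ζ / (1 - ζ)) 0 :=
    continuousAt_id.div (by fun_prop) (by simp)
  exact continuousAt_const.add (this.smul continuousAt_const)

theorem symbolInv_zero : R.symbolInv 0 = R.AC := by simp [symbolInv]

theorem StifflyAccurate.symbolInv_last (hR : R.StifflyAccurate) {ζ : ℂ} (hζ : 1 - ζ ≠ 0) :
    R.symbolInv ζ (Fin.last m) = (1 - ζ)⁻¹ • R.bC := by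
  funext k
  simp only [symbolInv, Matrix.add_apply, hR.AC_last, Matrix.smul_apply, Matrix.vecMulVec_apply,
    one_mul, Pi.smul_apply, smul_eq_mul]
  field_simp
  ring

theorem StifflyAccurate.q_vecMul_symbolInv (hR : R.StifflyAccurate) {z ζ : ℂ}
    (hz : IsUnit (1 - z • R.AC)) (hζ : 1 - ζ ≠ 0) :
    R.q z ᵥ* (1 - z • R.symbolInv ζ) = (1 - ζ * R.stab z) • R.symbolInv ζ (Fin.last m) := by
  have hsub : 1 - z • R.symbolInv ζ = (1 - z • R.AC) -
      (z * (ζ / (1 - ζ))) • Matrix.vecMulVec (fun _ => 1) R.bC := by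
    rw [symbolInv, smul_add, smul_smul, sub_sub]
  rw [hsub, Matrix.vecMul_sub, q_vecMul hz, Matrix.vecMul_smul, Matrix.vecMul_vecMulVec,
    hR.symbolInv_last hζ, stab_eq]
  funext k
  simp only [Pi.sub_apply, Pi.smul_apply, smul_eq_mul]
  field_simp
  ring

theorem StifflyAccurate.inv_symbol_sub_last (hR : R.StifflyAccurate) {z ζ : ℂ}
    (hz : IsUnit (1 - z • R.AC)) (hζ : 1 - ζ ≠ 0) (hstab : 1 - ζ * R.stab z ≠ 0)
    (hsymbol : IsUnit (R.symbolInv ζ)) (hresolvent : IsUnit (1 - z • R.symbolInv ζ)) :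
    (R.symbol ζ - z • 1)⁻¹ (Fin.last m) = (1 - ζ * R.stab z)⁻¹ • R.q z := by
  have hdet := (Matrix.isUnit_iff_isUnit_det _).1 hsymbol
  have hfactor : R.symbol ζ - z • 1 = (1 - z • R.symbolInv ζ) * (R.symbolInv ζ)⁻¹ := by
    rw [sub_mul, one_mul, smul_mul_assoc, Matrix.mul_nonsing_inv _ hdet]
    rfl
  have hrow : R.symbolInv ζ (Fin.last m) = Pi.single (Fin.last m) 1 ᵥ* R.symbolInv ζ :=
    (Matrix.single_one_vecMul _ _).symm
  rw [hfactor]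
  refine matrix_inv_apply_eq_of_vecMul_eq_single
    (hresolvent.mul (Matrix.isUnit_nonsing_inv_iff.2 hsymbol)) ?_
  rw [← Matrix.vecMul_vecMul, Matrix.smul_vecMul, hR.q_vecMul_symbolInv hz hζ, smul_smul,
    inv_mul_cancel₀ hstab, one_smul, hrow, Matrix.vecMul_vecMul, Matrix.mul_nonsing_inv _ hdet,
    Matrix.vecMul_one]

theorem StifflyAccurate.e_eq (hR : R.StifflyAccurate) {z : ℂ} (hz : IsUnit (1 - z • R.AC))
    (n : ℕ) : R.e n z = R.stab z ^ n • R.q z := by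
  have hD := continuousAt_symbolInv_zero (R := R)
  have hsymbol : ∀ᶠ ζ in 𝓝 (0 : ℂ), IsUnit (R.symbolInv ζ) :=
    eventually_isUnit_matrix hD (by rw [symbolInv_zero]; exact hR.isUnit_AC)
  have hresolvent : ∀ᶠ ζ in 𝓝 (0 : ℂ), IsUnit (1 - z • R.symbolInv ζ) :=
    eventually_isUnit_matrix (tendsto_const_nhds.sub (hD.tendsto.const_smul z))
      (by rw [symbolInv_zero]; exact hz)
  have hone : ∀ᶠ ζ in 𝓝 (0 : ℂ), 1 - ζ ≠ 0 :=
    ContinuousAt.eventually_ne (by fun_prop) (by simp)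
  have hstab : ∀ᶠ ζ in 𝓝 (0 : ℂ), 1 - ζ * R.stab z ≠ 0 :=
    ContinuousAt.eventually_ne (by fun_prop) (by simp)
  funext k
  refine iteratedDeriv_div_factorial_of_eventuallyEq_geometric ?_ n
  filter_upwards [hsymbol, hresolvent, hone, hstab] with ζ hsymbol hresolvent hone hstab
  rw [hR.inv_symbol_sub_last hz hone hstab hsymbol hresolvent, Pi.smul_apply, smul_eq_mul]

theorem q_eq_inv_smul {z : ℂ} (hz : z ≠ 0) (hunit : IsUnit (z⁻¹ • 1 - R.AC)) :
    R.q z = z⁻¹ • (R.bC ᵥ* (z⁻¹ • 1 - R.AC)⁻¹) := by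
  let := invertibleOfNonzero hz
  have hfactor : 1 - z • R.AC = z • (z⁻¹ • 1 - R.AC) := by rw [smul_sub, smul_inv_smul₀ hz]
  rw [q, hfactor, Matrix.inv_smul _ _ ((Matrix.isUnit_iff_isUnit_det _).1 hunit), invOf_eq_inv,
    Matrix.vecMul_smul]

theorem StifflyAccurate.tendsto_q_cobounded (hR : R.StifflyAccurate) :
    Tendsto R.q (cobounded ℂ) (𝓝 0) := by
  have hinv : Tendsto (fun z : ℂ => z⁻¹) (cobounded ℂ) (𝓝 0) := tendsto_inv₀_cobounded
  have hmatrix : Tendsto (fun z : ℂ => z⁻¹ • (1 : Matrix (Fin (m + 1)) (Fin (m + 1)) ℂ) - R.AC)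
      (cobounded ℂ) (𝓝 (-R.AC)) := by
    simpa only [zero_smul, zero_sub] using (hinv.smul_const 1).sub_const R.AC
  have hresolvent := tendsto_matrix_inv hmatrix hR.isUnit_AC.neg
  have hq : Tendsto (fun z : ℂ => z⁻¹ • (R.bC ᵥ* (z⁻¹ • 1 - R.AC)⁻¹)) (cobounded ℂ) (𝓝 0) := by
    have hcont : Continuous fun X : Matrix (Fin (m + 1)) (Fin (m + 1)) ℂ => R.bC ᵥ* X :=
      continuous_const.matrix_vecMul continuous_id
    simpa only [zero_smul, Function.comp_apply] using hinv.smul ((hcont.tendsto _).comp hresolvent)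
  refine hq.congr' ?_
  filter_upwards [eventually_ne_cobounded 0,
    eventually_isUnit_matrix hmatrix hR.isUnit_AC.neg] with z hz hunit
  exact (q_eq_inv_smul hz hunit).symm

theorem bddAbove_qNorms (hA : R.AStable) (hR : R.StifflyAccurate)
    (N : Seminorm ℂ (Fin (m + 1) → ℂ)) : BddAbove (R.qNorms N) := by
  have hN : Continuous N :=
    continuousOn_univ.1 (N.convexOn.continuousOn isOpen_univ)
  have hlim : Tendsto (fun z => N (R.q z)) (cocompact ℂ) (𝓝 0) := by
    rw [← Metric.cobounded_eq_cocompact]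
    simpa only [map_zero, Function.comp_def] using (hN.tendsto 0).comp hR.tendsto_q_cobounded
  obtain ⟨K, hK, hKc⟩ := mem_cocompact.1 (hlim.eventually_lt_const one_pos)
  have hbdd : BddAbove ((fun z => N (R.q z)) '' (K ∩ {z : ℂ | z.re ≤ 0})) :=
    (hK.inter_right (isClosed_le Complex.continuous_re continuous_const)).bddAbove_image
      fun z hz => (hN.continuousAt.comp (differentiableAt_q
        (hA.isUnit_of_re_nonpos z hz.2)).continuousAt).continuousWithinAt
  obtain ⟨C, hC⟩ := hbdd
  refine ⟨max C 1, ?_⟩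
  rintro _ ⟨z, hz, rfl⟩
  by_cases hzK : z ∈ K
  · exact le_max_of_le_left (hC ⟨z, ⟨hzK, hz⟩, rfl⟩)
  · exact le_max_of_le_right (hKc hzK).le

end Resolvent

end RungeKutta

/-! ### The decay rate `γ` -/

namespace RungeKutta

variable {m : ℕ} {R : RungeKutta m}

/-- The values of `log |r(z)| / Re z` on the strip `-ξ ≤ Re z < 0`, whose infimum is `γ(ξ)`. As in
`gamma`, the zeros of `r` are left out. -/
def decayRates (R : RungeKutta m) (ξ : ℝ) : Set ℝ :=
  {t | ∃ z : ℂ, -ξ ≤ z.re ∧ z.re < 0 ∧ R.stab z ≠ 0 ∧ t = Real.log ‖R.stab z‖ / z.re}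

namespace AStable

theorem continuousAt_stab (hR : R.AStable) {z : ℂ} (hz : z.re ≤ 0) : ContinuousAt R.stab z :=
  (differentiableAt_stab (hR.isUnit_of_re_nonpos z hz)).continuousAt

theorem nonneg_of_mem_decayRates (hR : R.AStable) {ξ t : ℝ} (ht : t ∈ R.decayRates ξ) : 0 ≤ t := by
  obtain ⟨z, -, hz, -, rfl⟩ := ht
  exact div_nonneg_of_nonpos (Real.log_nonpos (norm_nonneg _) (hR.norm_stab_le z hz.le)) hz.le

theorem gamma_nonneg (hR : R.AStable) (ξ : ℝ) : 0 ≤ R.gamma ξ :=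
  Real.sInf_nonneg fun _ => hR.nonneg_of_mem_decayRates

theorem gamma_le (hR : R.AStable) {ξ : ℝ} {z : ℂ} (hξ : -ξ ≤ z.re) (hz : z.re < 0)
    (hstab : R.stab z ≠ 0) : R.gamma ξ ≤ Real.log ‖R.stab z‖ / z.re :=
  csInf_le ⟨0, fun _ => hR.nonneg_of_mem_decayRates⟩ ⟨z, hξ, hz, hstab, rfl⟩

theorem decayRates_nonempty (hR : R.AStable) {ξ : ℝ} (hξ : 0 < ξ) : (R.decayRates ξ).Nonempty := by
  have hlim : Tendsto (fun ε : ℝ => ((-ε : ℝ) : ℂ)) (𝓝[>] 0) (𝓝 0) := by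
    simpa using (Continuous.tendsto (by fun_prop : Continuous fun ε : ℝ => ((-ε : ℝ) : ℂ))
      0).mono_left nhdsWithin_le_nhds
  have hstab : ∀ᶠ z in 𝓝 (0 : ℂ), R.stab z ≠ 0 :=
    (hR.continuousAt_stab le_rfl).eventually_ne (stab_zero.trans_ne one_ne_zero)
  obtain ⟨ε, hε, hεpos, hεξ⟩ := ((hlim.eventually hstab).and (Ioc_mem_nhdsGT hξ)).exists
  exact ⟨_, ((-ε : ℝ) : ℂ), by simpa using hεξ, by simpa using hεpos, hε, rfl⟩

theorem antitoneOn_gamma (hR : R.AStable) : AntitoneOn R.gamma (Set.Ioi 0) := by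
  intro ξ hξ ξ' _ h
  refine le_csInf (hR.decayRates_nonempty hξ) ?_
  rintro _ ⟨z, hzξ, hz, hstab, rfl⟩
  exact hR.gamma_le (by linarith) hz hstab

/-- Almost optimal points for `γ(ξ)` can be moved off the line `Re z = -ξ`, and are then admissible
for all `ξ'` near `ξ`. -/
theorem upperSemicontinuousAt_gamma (hR : R.AStable) {ξ : ℝ} (hξ : 0 < ξ) :
    UpperSemicontinuousAt R.gamma ξ := by
  intro t ht
  obtain ⟨_, ⟨z, hzξ, hz, hstab, rfl⟩, hlt⟩ :=
    exists_lt_of_csInf_lt (hR.decayRates_nonempty hξ) ht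
  have hstab_cont := hR.continuousAt_stab hz.le
  have hrate : ContinuousAt (fun w : ℂ => Real.log ‖R.stab w‖ / w.re) z :=
    (hstab_cont.norm.log (norm_ne_zero_iff.2 hstab)).div Complex.continuous_re.continuousAt hz.ne
  have hnear : ∀ᶠ w in 𝓝 z, R.stab w ≠ 0 ∧ Real.log ‖R.stab w‖ / w.re < t ∧ w.re < 0 :=
    (hstab_cont.eventually_ne hstab).and ((hrate.eventually_lt_const hlt).and
      (Complex.continuous_re.continuousAt.eventually_lt_const hz))
  have hshift : Tendsto (fun ε : ℝ => z + ε) (𝓝[>] 0) (𝓝 z) := by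
    simpa using (Continuous.tendsto (by fun_prop : Continuous fun ε : ℝ => z + (ε : ℂ))
      0).mono_left nhdsWithin_le_nhds
  obtain ⟨ε, ⟨hstab', hlt', hre⟩, hε⟩ := ((hshift.eventually hnear).and self_mem_nhdsWithin).exists
  have hinside : -(z + ε).re < ξ := by
    rw [Complex.add_re, Complex.ofReal_re]
    linarith [show 0 < ε from hε]
  filter_upwards [lt_mem_nhds hinside] with ξ' hξ'
  exact (hR.gamma_le (by linarith) hre hstab').trans_lt hlt'

theorem norm_stab_pow_le (hR : R.AStable) {ξ : ℝ} {z : ℂ} (hξ : -ξ ≤ z.re) (hz : z.re < 0)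
    (n : ℕ) : ‖R.stab z‖ ^ n ≤ Real.exp (n * (R.gamma ξ * z.re)) := by
  rw [Real.exp_nat_mul]
  refine pow_le_pow_left₀ (norm_nonneg _) ?_ n
  by_cases hstab : R.stab z = 0
  · rw [hstab, norm_zero]
    exact (Real.exp_pos _).le
  · rw [← Real.log_le_iff_le_exp (norm_pos_iff.2 hstab)]
    exact (le_div_iff_of_neg hz).1 (hR.gamma_le hξ hz hstab)

end AStable

end RungeKutta

/-! ### Attainment of the minimum -/

theorem exists_isMinOn_Ioo {f : ℝ → ℝ} {a b : ℝ} (hab : a < b)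
    (hf : LowerSemicontinuousOn f (Set.Ioo a b))
    (ha : Tendsto f (𝓝[>] a) atTop) (hb : Tendsto f (𝓝[<] b) atTop) :
    ∃ x ∈ Set.Ioo a b, IsMinOn f (Set.Ioo a b) x := by
  obtain ⟨c, hac, hcb⟩ := exists_between hab
  obtain ⟨a', haa', ha'⟩ := mem_nhdsGT_iff_exists_Ioo_subset.1 (ha.eventually_gt_atTop (f c))
  obtain ⟨b', hbb', hb'⟩ := mem_nhdsLT_iff_exists_Ioo_subset.1 (hb.eventually_gt_atTop (f c))
  have ha'c : a' ≤ c := not_lt.1 fun h => lt_irrefl (f c) (ha' ⟨hac, h⟩)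
  have hcb' : c ≤ b' := not_lt.1 fun h => lt_irrefl (f c) (hb' ⟨h, hcb⟩)
  have hsub : Set.Icc a' b' ⊆ Set.Ioo a b := fun x hx =>
    ⟨haa'.trans_le hx.1, hx.2.trans_lt hbb'⟩
  obtain ⟨x, hx, hmin⟩ := LowerSemicontinuousOn.exists_isMinOn
    (Set.nonempty_Icc.2 (ha'c.trans hcb')) isCompact_Icc (hf.mono hsub)
  have hxc : f x ≤ f c := hmin ⟨ha'c, hcb'⟩
  refine ⟨x, hsub hx, fun y hy => ?_⟩
  rcases lt_or_ge y a' with hya | hya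
  · exact hxc.trans (ha' ⟨hy.1, hya⟩).le
  rcases lt_or_ge b' y with hyb | hyb
  · exact hxc.trans (hb' ⟨hyb, hy.2⟩).le
  · exact hmin ⟨hya, hyb⟩

theorem lowerSemicontinuousAt_apply_of_antitone {X : Type*} [TopologicalSpace X] {H : X → ℝ → ℝ}
    {g : X → ℝ} {x : X} (hH : ∀ s, ContinuousAt (fun y => H y s) x)
    (hHx : ContinuousAt (H x) (g x)) (hanti : ∀ᶠ y in 𝓝 x, Antitone (H y))
    (hg : UpperSemicontinuousAt g x) : LowerSemicontinuousAt (fun y => H y (g y)) x := by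
  intro c hc
  obtain ⟨s, hcs, hgs⟩ := (((hHx.eventually_const_lt hc).filter_mono nhdsWithin_le_nhds).and
    (self_mem_nhdsWithin : Set.Ioi (g x) ∈ 𝓝[>] g x)).exists
  filter_upwards [hg s hgs, (hH s).eventually_const_lt hcs, hanti] with y hgy hcy hy
  exact hcy.trans_le (hy hgy.le)

section Eta

variable {B ρ : ℝ}

theorem strictMonoOn_add_inv : StrictMonoOn (fun r : ℝ => r + r⁻¹) (Set.Ici 1) := by
  intro r hr s _ hrs
  have hr1 : 1 ≤ r := hr
  have hpos : 0 < (s - r) * (r * s - 1) / (r * s) :=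
    div_pos (mul_pos (by linarith) (by nlinarith)) (by nlinarith)
  have heq : s + s⁻¹ - (r + r⁻¹) = (s - r) * (r * s - 1) / (r * s) := by
    have : r ≠ 0 := by linarith
    have : s ≠ 0 := by linarith
    field_simp
    ring
  exact sub_pos.1 (heq ▸ hpos)

theorem strictAntiOn_etaMinus (hB : 0 < B) : StrictAntiOn (etaMinus B) (Set.Ici 1) := by
  intro r hr s hs hrs
  have := mul_lt_mul_of_pos_left (strictMonoOn_add_inv hr hs hrs) hB
  simp only [etaMinus]
  linarith

theorem etaMinus_one : etaMinus B 1 = 1 := by norm_num [etaMinus]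

theorem one_lt_rhoMax (hB : 0 < B) : 1 < rhoMax B := by
  have : 0 < 2 / B * (1 + Real.sqrt (1 + B)) := by positivity
  rw [rhoMax]
  linarith

theorem inv_rhoMax (hB : 0 < B) : (rhoMax B)⁻¹ = 1 + 2 / B * (1 - Real.sqrt (1 + B)) := by
  refine inv_eq_of_mul_eq_one_right ?_
  rw [rhoMax]
  field_simp
  linear_combination -4 * Real.sq_sqrt (show (0 : ℝ) ≤ 1 + B by linarith)

theorem etaMinus_rhoMax (hB : 0 < B) : etaMinus B (rhoMax B) = 0 := by
  rw [etaMinus, inv_rhoMax hB, rhoMax]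
  field_simp
  ring

theorem etaMinus_pos (hB : 0 < B) (h1 : 1 ≤ ρ) (hmax : ρ < rhoMax B) : 0 < etaMinus B ρ :=
  etaMinus_rhoMax hB ▸ strictAntiOn_etaMinus hB h1 (one_lt_rhoMax hB).le hmax

theorem etaMinus_le_one (hB : 0 < B) (h1 : 1 ≤ ρ) : etaMinus B ρ ≤ 1 :=
  etaMinus_one (B := B) ▸ (strictAntiOn_etaMinus hB).antitoneOn Set.self_mem_Ici h1 h1

theorem one_le_etaPlus (hB : 0 ≤ B) (hρ : 0 ≤ ρ) : 1 ≤ etaPlus B ρ :=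
  le_add_of_nonneg_right (by positivity)

theorem continuousAt_etaMinus (h : ρ ≠ 0) : ContinuousAt (etaMinus B) ρ := by
  unfold etaMinus
  fun_prop (disch := assumption)

theorem continuousAt_etaPlus (h : ρ ≠ 0) : ContinuousAt (etaPlus B) ρ := by
  unfold etaPlus
  fun_prop (disch := assumption)

end Eta

section BoundPrefactor

variable {B : ℝ} (Q : ℕ)

/-- The factor of `boundFun` in front of the exponential. -/
noncomputable def boundPrefactor (B ρ : ℝ) : ℝ :=
  ρ ^ (-2 * (Q : ℤ) + 1) / (ρ - 1) * (etaMinus B ρ) ^ (-(1 / 2) : ℝ)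

theorem boundPrefactor_pos (hB : 0 < B) {ρ : ℝ} (hρ : ρ ∈ Set.Ioo 1 (rhoMax B)) :
    0 < boundPrefactor Q B ρ :=
  mul_pos (div_pos (zpow_pos (one_pos.trans hρ.1) _) (sub_pos.2 hρ.1))
    (Real.rpow_pos_of_pos (etaMinus_pos hB hρ.1.le hρ.2) _)

theorem continuousAt_boundPrefactor (hB : 0 < B) {ρ : ℝ} (hρ : ρ ∈ Set.Ioo 1 (rhoMax B)) :
    ContinuousAt (boundPrefactor Q B) ρ := by
  have h0 : ρ ≠ 0 := (one_pos.trans hρ.1).ne'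
  exact ((continuousAt_id.zpow₀ _ (Or.inl h0)).div (continuousAt_id.sub continuousAt_const)
    (sub_ne_zero.2 hρ.1.ne')).mul ((continuousAt_etaMinus h0).rpow_const
      (Or.inl (etaMinus_pos hB hρ.1.le hρ.2).ne'))

theorem tendsto_boundPrefactor_one (hB : 0 < B) :
    Tendsto (boundPrefactor Q B) (𝓝[>] 1) atTop := by
  have hη := etaMinus_pos hB le_rfl (one_lt_rhoMax hB)
  have hpole : Tendsto (fun ρ : ℝ => (ρ - 1)⁻¹) (𝓝[>] 1) atTop := by
    refine Tendsto.inv_tendsto_nhdsGT_zero (tendsto_nhdsWithin_iff.2 ⟨?_, ?_⟩)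
    · simpa using (Continuous.tendsto (by fun_prop : Continuous fun ρ : ℝ => ρ - 1)
        1).mono_left nhdsWithin_le_nhds
    · filter_upwards [self_mem_nhdsWithin] with ρ hρ
      exact sub_pos.2 (Set.mem_Ioi.1 hρ)
  have hrest : ContinuousAt
      (fun ρ : ℝ => ρ ^ (-2 * (Q : ℤ) + 1) * (etaMinus B ρ) ^ (-(1 / 2) : ℝ)) 1 :=
    (continuousAt_id.zpow₀ _ (Or.inl one_ne_zero)).mul
      ((continuousAt_etaMinus one_ne_zero).rpow_const (Or.inl hη.ne'))
  refine (hpole.atTop_mul_pos (mul_pos (zpow_pos one_pos _) (Real.rpow_pos_of_pos hη _))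
    (hrest.tendsto.mono_left nhdsWithin_le_nhds)).congr fun ρ => ?_
  rw [boundPrefactor]
  ring

theorem tendsto_rpow_neg_nhdsGT_zero {r : ℝ} (hr : 0 < r) :
    Tendsto (fun x : ℝ => x ^ (-r)) (𝓝[>] 0) atTop := by
  refine ((tendsto_rpow_atTop hr).comp tendsto_inv_nhdsGT_zero).congr' ?_
  filter_upwards [self_mem_nhdsWithin] with x hx
  rw [Real.rpow_neg (Set.mem_Ioi.1 hx).le, Function.comp_apply, Real.inv_rpow (Set.mem_Ioi.1 hx).le]

theorem tendsto_boundPrefactor_rhoMax (hB : 0 < B) :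
    Tendsto (boundPrefactor Q B) (𝓝[<] rhoMax B) atTop := by
  have hmax := one_lt_rhoMax hB
  have h0 : 0 < rhoMax B := one_pos.trans hmax
  have hη : Tendsto (etaMinus B) (𝓝[<] rhoMax B) (𝓝[>] 0) := by
    refine tendsto_nhdsWithin_iff.2 ⟨?_, ?_⟩
    · simpa only [etaMinus_rhoMax hB] using
        (continuousAt_etaMinus (B := B) h0.ne').tendsto.mono_left nhdsWithin_le_nhds
    · filter_upwards [Ioo_mem_nhdsLT hmax] with ρ hρ
      exact etaMinus_pos hB hρ.1.le hρ.2
  have hrest : ContinuousAt (fun ρ : ℝ => ρ ^ (-2 * (Q : ℤ) + 1) / (ρ - 1)) (rhoMax B) :=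
    (continuousAt_id.zpow₀ _ (Or.inl h0.ne')).div (continuousAt_id.sub continuousAt_const)
      (sub_ne_zero.2 hmax.ne')
  exact (hrest.tendsto.mono_left nhdsWithin_le_nhds).pos_mul_atTop
    (div_pos (zpow_pos h0 _) (sub_pos.2 hmax))
    ((tendsto_rpow_neg_nhdsGT_zero (by norm_num)).comp hη)

end BoundPrefactor

section BoundFun

variable {m : ℕ} {R : RungeKutta m} (Q : ℕ) {h d t B L : ℝ}

/-- The positive term of the exponent in `boundFun`; it bounds the growth of the kernel. -/
noncomputable def boundGrowth (d B L ρ : ℝ) : ℝ :=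
  d * L ^ (1 / 2 : ℝ) * (1 + (ρ / 2) ^ 2) ^ (1 / 4 : ℝ) * (etaPlus B ρ) ^ (1 / 2 : ℝ)

theorem boundFun_eq (ρ : ℝ) : boundFun R Q h d t B L ρ = boundPrefactor Q B ρ *
    Real.exp (boundGrowth d B L ρ - L * t * R.gamma (h * L * etaPlus B ρ) * etaMinus B ρ) := rfl

theorem boundGrowth_nonneg (hd : 0 ≤ d) (hB : 0 ≤ B) (hL : 0 ≤ L) {ρ : ℝ} (hρ : 0 ≤ ρ) :
    0 ≤ boundGrowth d B L ρ := by
  have := one_le_etaPlus hB hρ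
  unfold boundGrowth
  positivity

theorem continuousAt_boundGrowth {ρ : ℝ} (hρ : ρ ≠ 0) : ContinuousAt (boundGrowth d B L) ρ :=
  (continuousAt_const.mul (ContinuousAt.rpow_const (by fun_prop) (Or.inr (by norm_num)))).mul
    ((continuousAt_etaPlus hρ).rpow_const (Or.inr (by norm_num)))

theorem lowerSemicontinuousOn_boundFun (hR : R.AStable) (hh : 0 < h) (ht : 0 ≤ t) (hB : 0 < B)
    (hL : 0 < L) : LowerSemicontinuousOn (boundFun R Q h d t B L) (Set.Ioo 1 (rhoMax B)) := by
  intro ρ hρ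
  have h0 : 0 < ρ := one_pos.trans hρ.1
  have hη := one_le_etaPlus hB.le h0.le
  refine (lowerSemicontinuousAt_apply_of_antitone (H := fun r s => boundPrefactor Q B r *
    Real.exp (boundGrowth d B L r - L * t * s * etaMinus B r))
    (g := fun r => R.gamma (h * L * etaPlus B r)) (fun s => ?_)
    (Continuous.continuousAt (by fun_prop)) ?_ ?_).lowerSemicontinuousWithinAt _
  · exact (continuousAt_boundPrefactor Q hB hρ).mul (((continuousAt_boundGrowth h0.ne').sub
      (continuousAt_const.mul (continuousAt_etaMinus h0.ne'))).rexp)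
  · filter_upwards [Ioo_mem_nhds hρ.1 hρ.2] with r hr s s' hs
    have hpre := (boundPrefactor_pos Q hB hr).le
    have hηr := (etaMinus_pos hB hr.1.le hr.2).le
    dsimp only
    gcongr
  · exact (hR.upperSemicontinuousAt_gamma (by positivity)).comp
      (continuousAt_const.mul (continuousAt_etaPlus h0.ne'))

theorem boundPrefactor_mul_le_boundFun (hR : R.AStable) (hh : 0 < h) (hd : 0 ≤ d) (ht : 0 ≤ t)
    (hB : 0 < B) (hL : 0 < L) {ρ : ℝ} (hρ : ρ ∈ Set.Ioo 1 (rhoMax B)) :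
    boundPrefactor Q B ρ * Real.exp (-(L * t * R.gamma (h * L))) ≤ boundFun R Q h d t B L ρ := by
  have h0 : 0 < ρ := one_pos.trans hρ.1
  have hη := one_le_etaPlus hB.le h0.le
  have hγ : R.gamma (h * L * etaPlus B ρ) ≤ R.gamma (h * L) :=
    hR.antitoneOn_gamma (Set.mem_Ioi.2 (by positivity)) (Set.mem_Ioi.2 (by positivity))
      (le_mul_of_one_le_right (by positivity) hη)
  have hdecay : L * t * R.gamma (h * L * etaPlus B ρ) * etaMinus B ρ ≤
      L * t * R.gamma (h * L) * 1 := by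
    have := hR.gamma_nonneg (h * L)
    have := (etaMinus_pos hB hρ.1.le hρ.2).le
    gcongr
    exact etaMinus_le_one hB hρ.1.le
  have hgrowth := boundGrowth_nonneg hd hB.le hL.le h0.le
  have hpre := (boundPrefactor_pos Q hB hρ).le
  rw [boundFun_eq]
  gcongr
  linarith

theorem exists_isLeast_boundFun (hR : R.AStable) (hh : 0 < h) (hd : 0 ≤ d) (ht : 0 ≤ t)
    (hB : 0 < B) (hL : 0 < L) :
    ∃ ρ ∈ Set.Ioo 1 (rhoMax B), IsLeast (boundFun R Q h d t B L '' Set.Ioo 1 (rhoMax B))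
      (boundFun R Q h d t B L ρ) := by
  have hmax := one_lt_rhoMax hB
  have hexp : 0 < Real.exp (-(L * t * R.gamma (h * L))) := Real.exp_pos _
  have hle : ∀ ρ ∈ Set.Ioo 1 (rhoMax B), boundPrefactor Q B ρ *
      Real.exp (-(L * t * R.gamma (h * L))) ≤ boundFun R Q h d t B L ρ :=
    fun ρ => boundPrefactor_mul_le_boundFun Q hR hh hd ht hB hL
  obtain ⟨ρ, hρ, hmin⟩ := exists_isMinOn_Ioo hmax
    (lowerSemicontinuousOn_boundFun (d := d) Q hR hh ht hB hL)
    (tendsto_atTop_mono' _ (mem_of_superset (Ioo_mem_nhdsGT hmax) hle)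
      ((tendsto_boundPrefactor_one Q hB).atTop_mul_const hexp))
    (tendsto_atTop_mono' _ (mem_of_superset (Ioo_mem_nhdsLT hmax) hle)
      ((tendsto_boundPrefactor_rhoMax Q hB).atTop_mul_const hexp))
  exact ⟨ρ, hρ, Set.mem_image_of_mem _ hρ, Set.forall_mem_image.2 fun r hr => hmin hr⟩

end BoundFun

/-! ### The kernel off the real axis -/

/-- The holomorphic branch of `√(i λ)` on `ℂ ∖ (-∞, 0]`. -/
noncomputable def sqrtI (lam : ℂ) : ℂ := Complex.exp (Real.pi / 4 * Complex.I) * lam ^ (2⁻¹ : ℂ)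

/-- The holomorphic extension of `G(·, x)` to `ℂ ∖ (-∞, 0]`. -/
noncomputable def jump (x : ℝ) (lam : ℂ) : ℂ := -(Complex.cosh (|x| * sqrtI lam) / sqrtI lam)

theorem norm_sqrtI (lam : ℂ) : ‖sqrtI lam‖ = Real.sqrt ‖lam‖ := by
  have hphase : ‖Complex.exp (Real.pi / 4 * Complex.I)‖ = 1 := by
    exact_mod_cast Complex.norm_exp_ofReal_mul_I (Real.pi / 4)
  rw [sqrtI, norm_mul, hphase, one_mul, Real.sqrt_eq_rpow, one_div]
  exact_mod_cast Complex.norm_cpow_inv_nat lam 2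

theorem sqrtI_ne_zero {lam : ℂ} (h : lam ≠ 0) : sqrtI lam ≠ 0 := by
  rw [← norm_ne_zero_iff, norm_sqrtI]
  exact (Real.sqrt_pos.2 (norm_pos_iff.2 h)).ne'

theorem differentiableAt_sqrtI {lam : ℂ} (h : lam ∈ Complex.slitPlane) :
    DifferentiableAt ℂ sqrtI lam :=
  (differentiableAt_id.cpow_const h).const_mul _

theorem differentiableAt_jump (x : ℝ) {lam : ℂ} (h : lam ∈ Complex.slitPlane) :
    DifferentiableAt ℂ (jump x) lam :=
  (((differentiableAt_sqrtI h).const_mul _).ccosh.div (differentiableAt_sqrtI h)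
    (sqrtI_ne_zero (Complex.slitPlane_ne_zero h))).neg

theorem sqrtI_ofReal {lam : ℝ} (h : 0 ≤ lam) :
    sqrtI lam = Complex.exp (Real.pi / 4 * Complex.I) * (Real.sqrt lam : ℂ) := by
  rw [sqrtI, Real.sqrt_eq_rpow, Complex.ofReal_cpow h]
  norm_num

theorem G_eq_jump (x : ℝ) {lam : ℝ} (h : 0 ≤ lam) : G lam x = jump x lam := by
  have hupper : Complex.exp (-(Real.pi / 4) * Complex.I) * (Real.sqrt lam : ℂ) *
      Complex.exp ((Real.pi : ℝ) / 2 * Complex.I) = sqrtI lam := by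
    rw [sqrtI_ofReal h, mul_right_comm, ← Complex.exp_add]
    congr 2
    ring
  have hlower : Complex.exp (-(Real.pi / 4) * Complex.I) * (Real.sqrt lam : ℂ) *
      Complex.exp ((-Real.pi : ℝ) / 2 * Complex.I) = -sqrtI lam := by
    rw [sqrtI_ofReal h, mul_right_comm, ← Complex.exp_add, ← neg_mul, ← Complex.exp_sub_pi_mul_I]
    congr 2
    push_cast
    ring
  simp only [G, kernelPolar, hupper, hlower, jump, Complex.cosh]
  rcases eq_or_ne (sqrtI lam) 0 with h0 | h0
  · simp [h0]
  · field_simp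
    ring_nf

theorem norm_cosh_le_exp_norm (z : ℂ) : ‖Complex.cosh z‖ ≤ Real.exp ‖z‖ := by
  have hpos := Complex.norm_exp_le_exp_norm z
  have hneg := Complex.norm_exp_le_exp_norm (-z)
  rw [norm_neg] at hneg
  rw [Complex.cosh, norm_div, Complex.norm_ofNat, div_le_iff₀ two_pos]
  linarith [norm_add_le (Complex.exp z) (Complex.exp (-z))]

theorem norm_jump_le (x : ℝ) (lam : ℂ) :
    ‖jump x lam‖ ≤ (Real.sqrt ‖lam‖)⁻¹ * Real.exp (|x| * Real.sqrt ‖lam‖) := by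
  rw [jump, norm_neg, norm_div, norm_sqrtI, div_eq_inv_mul]
  gcongr
  simpa only [norm_mul, norm_sqrtI, Complex.norm_real, norm_abs_eq_norm, Real.norm_eq_abs,
    abs_abs] using norm_cosh_le_exp_norm (|x| * sqrtI lam)

/-! ### The transplanted Bernstein ellipse -/

section Ellipse

variable {B L ρ : ℝ} {w : ℂ}

theorem abs_re_le_of_mem_bernsteinEllipse (hw : w ∈ bernsteinEllipse ρ) :
    |w.re| ≤ (ρ + ρ⁻¹) / 2 := by
  obtain ⟨u, ⟨hu1, huρ⟩, rfl⟩ := hw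
  have hmono : ‖u‖ + ‖u‖⁻¹ ≤ ρ + ρ⁻¹ :=
    strictMonoOn_add_inv.monotoneOn hu1 (hu1.trans huρ) huρ
  have hadd := norm_add_le u u⁻¹
  rw [norm_inv] at hadd
  refine (Complex.abs_re_le_norm _).trans ?_
  rw [joukowski, norm_div, Complex.norm_ofNat]
  linarith

theorem abs_im_le_of_mem_bernsteinEllipse (hw : w ∈ bernsteinEllipse ρ) : |w.im| ≤ ρ / 2 := by
  obtain ⟨u, ⟨hu1, huρ⟩, rfl⟩ := hw
  have him : (joukowski u).im = u.im * ((1 - (Complex.normSq u)⁻¹) / 2) := by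
    rw [joukowski, Complex.div_ofNat_im, Complex.add_im, Complex.inv_im]
    ring
  have hnormSq : 1 ≤ Complex.normSq u := by
    rw [Complex.normSq_eq_norm_sq]
    exact one_le_pow₀ hu1
  have hinv : (Complex.normSq u)⁻¹ ≤ 1 := inv_le_one_of_one_le₀ hnormSq
  have hinv0 : 0 ≤ (Complex.normSq u)⁻¹ := inv_nonneg.2 (Complex.normSq_nonneg u)
  rw [him, abs_mul, abs_of_nonneg (show 0 ≤ (1 - (Complex.normSq u)⁻¹) / 2 by linarith),
    div_eq_mul_one_div ρ]
  exact mul_le_mul ((Complex.abs_im_le_norm u).trans huρ) (by linarith) (by linarith)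
    ((norm_nonneg u).trans huρ)

theorem transplant_re (a b : ℝ) (w : ℂ) :
    (transplant a b w).re = a + (b - a) / 2 * (w.re + 1) := by
  simp [transplant, ← Complex.ofReal_sub]

theorem transplant_im (a b : ℝ) (w : ℂ) : (transplant a b w).im = (b - a) / 2 * w.im := by
  simp [transplant, ← Complex.ofReal_sub]

theorem mul_etaMinus_le_re_transplant (hB : 0 ≤ B) (hL : 0 ≤ L) (hw : w ∈ bernsteinEllipse ρ) :
    L * etaMinus B ρ ≤ (transplant L ((1 + B) * L) w).re := by
  have := mul_le_mul_of_nonneg_left (abs_le.1 (abs_re_le_of_mem_bernsteinEllipse hw)).1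
    (mul_nonneg hB hL)
  rw [transplant_re, etaMinus]
  linarith

theorem re_transplant_le_mul_etaPlus (hB : 0 ≤ B) (hL : 0 ≤ L) (hw : w ∈ bernsteinEllipse ρ) :
    (transplant L ((1 + B) * L) w).re ≤ L * etaPlus B ρ := by
  have := mul_le_mul_of_nonneg_left (abs_le.1 (abs_re_le_of_mem_bernsteinEllipse hw)).2
    (mul_nonneg hB hL)
  rw [transplant_re, etaPlus]
  linarith

theorem abs_im_transplant_le (hB : 0 ≤ B) (hL : 0 ≤ L) (hρ : 0 < ρ)
    (hw : w ∈ bernsteinEllipse ρ) :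
    |(transplant L ((1 + B) * L) w).im| ≤ L * etaPlus B ρ * (ρ / 2) := by
  have hη : B / 2 ≤ etaPlus B ρ := by
    have : 0 ≤ B * (ρ + ρ⁻¹) := by positivity
    rw [etaPlus]
    linarith
  have hη0 : 0 ≤ L * etaPlus B ρ := mul_nonneg hL ((by positivity : 0 ≤ B / 2).trans hη)
  have hhalf : ((1 + B) * L - L) / 2 = L * (B / 2) := by ring
  rw [transplant_im, hhalf, abs_mul, abs_of_nonneg (by positivity)]
  have := abs_im_le_of_mem_bernsteinEllipse hw
  gcongr

theorem norm_le_mul_sqrt_one_add_sq {z : ℂ} {a c : ℝ} (hre : |z.re| ≤ a) (him : |z.im| ≤ a * c) :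
    ‖z‖ ≤ a * Real.sqrt (1 + c ^ 2) := by
  have ha : 0 ≤ a := (abs_nonneg _).trans hre
  refine le_of_sq_le_sq ?_ (by positivity)
  have hre2 := pow_le_pow_left₀ (abs_nonneg _) hre 2
  have him2 := pow_le_pow_left₀ (abs_nonneg _) him 2
  rw [← Complex.normSq_eq_norm_sq, Complex.normSq_apply, mul_pow, Real.sq_sqrt (by positivity),
    ← sq, ← sq, ← sq_abs z.re, ← sq_abs z.im]
  linarith

theorem norm_transplant_le (hB : 0 < B) (hL : 0 ≤ L) (hρ : ρ ∈ Set.Ioo 1 (rhoMax B))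
    (hw : w ∈ bernsteinEllipse ρ) :
    ‖transplant L ((1 + B) * L) w‖ ≤ L * etaPlus B ρ * Real.sqrt (1 + (ρ / 2) ^ 2) := by
  have hre : 0 ≤ (transplant L ((1 + B) * L) w).re :=
    (mul_nonneg hL (etaMinus_pos hB hρ.1.le hρ.2).le).trans
      (mul_etaMinus_le_re_transplant hB.le hL hw)
  refine norm_le_mul_sqrt_one_add_sq ?_ (abs_im_transplant_le hB.le hL (one_pos.trans hρ.1) hw)
  rw [abs_of_nonneg hre]
  exact re_transplant_le_mul_etaPlus hB.le hL hw

end Ellipse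

/-! ### The quadrature error -/

section QuadratureError

variable {m : ℕ} {R : RungeKutta m}

/-- The holomorphic extension of `integrand` to the right half-plane. -/
noncomputable def integrandExt (R : RungeKutta m) (h x : ℝ) (n : ℕ) (lam : ℂ) :
    Fin (m + 1) → ℂ :=
  (h / (2 * Real.pi * Complex.I) * jump x lam * R.stab (-(h * lam)) ^ n) • R.q (-(h * lam))

theorem RungeKutta.AStable.isUnit_one_sub_neg_mul (hR : R.AStable) {h : ℝ} (hh : 0 ≤ h) {lam : ℂ}
    (hlam : 0 ≤ lam.re) : IsUnit (1 - (-(h * lam)) • R.AC) :=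
  hR.isUnit_of_re_nonpos _ (by simpa using mul_nonneg hh hlam)

theorem integrand_eq (hA : R.AStable) (hR : R.StifflyAccurate) {h : ℝ} (hh : 0 ≤ h) (x : ℝ)
    (n : ℕ) {lam : ℝ} (hlam : 0 ≤ lam) : integrand R h x n lam = integrandExt R h x n lam := by
  rw [integrand, integrandExt, G_eq_jump x hlam, Complex.ofReal_mul,
    hR.e_eq (hA.isUnit_one_sub_neg_mul hh hlam), smul_smul]

theorem differentiableAt_integrandExt (hR : R.AStable) {h : ℝ} (hh : 0 ≤ h) (x : ℝ) (n : ℕ)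
    {lam : ℂ} (hlam : 0 < lam.re) : DifferentiableAt ℂ (integrandExt R h x n) lam := by
  have hunit := hR.isUnit_one_sub_neg_mul hh hlam.le
  have hscale : DifferentiableAt ℂ (fun w : ℂ => -(h * w)) lam := by fun_prop
  have hstab : DifferentiableAt ℂ (fun w : ℂ => R.stab (-(h * w))) lam :=
    DifferentiableAt.comp (g := R.stab) lam (RungeKutta.differentiableAt_stab hunit) hscale
  have hq : DifferentiableAt ℂ (fun w : ℂ => R.q (-(h * w))) lam :=
    DifferentiableAt.comp (g := R.q) lam (RungeKutta.differentiableAt_q hunit) hscale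
  exact (((differentiableAt_jump x (Or.inl hlam)).const_mul _).mul (hstab.pow n)).smul hq

theorem norm_stab_neg_mul_pow_le (hR : R.AStable) {h : ℝ} (hh : 0 < h) (n : ℕ) {lam : ℂ} {α β : ℝ}
    (hα : 0 < α) (hre : α ≤ lam.re) (hre' : lam.re ≤ β) :
    ‖R.stab (-(h * lam))‖ ^ n ≤ Real.exp (-(n * h * R.gamma (h * β) * α)) := by
  have hz : (-(h * lam)).re = -(h * lam.re) := by simp
  have hneg : (-(h * lam)).re < 0 := by
    rw [hz]
    exact neg_neg_of_pos (mul_pos hh (hα.trans_le hre))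
  refine (hR.norm_stab_pow_le (ξ := h * β) (by rw [hz]; gcongr) hneg n).trans
    (Real.exp_le_exp.2 ?_)
  have hγ := hR.gamma_nonneg (h * β)
  have : n * h * R.gamma (h * β) * α ≤ n * h * R.gamma (h * β) * lam.re := by gcongr
  rw [hz]
  linarith

theorem seminorm_integrandExt_le (hA : R.AStable) (hR : R.StifflyAccurate)
    (N : Seminorm ℂ (Fin (m + 1) → ℂ)) {h : ℝ} (hh : 0 < h) (x : ℝ) (n : ℕ) {lam : ℂ}
    {α β κ : ℝ} (hα : 0 < α) (hre : α ≤ lam.re) (hre' : lam.re ≤ β) (hκ : ‖lam‖ ≤ κ) :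
    N (integrandExt R h x n lam) ≤ h / (2 * Real.pi) * ((Real.sqrt α)⁻¹ *
      Real.exp (|x| * Real.sqrt κ)) * Real.exp (-(n * h * R.gamma (h * β) * α)) *
        sSup (R.qNorms N) := by
  have hq : N (R.q (-(h * lam))) ≤ sSup (R.qNorms N) :=
    le_csSup (RungeKutta.bddAbove_qNorms hA hR N)
      ⟨_, by simpa using mul_nonneg hh.le (hα.le.trans hre), rfl⟩
  have hstab := norm_stab_neg_mul_pow_le hA hh n hα hre hre'
  have hjump : ‖jump x lam‖ ≤ (Real.sqrt α)⁻¹ * Real.exp (|x| * Real.sqrt κ) := by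
    have hαlam : α ≤ ‖lam‖ := hre.trans (Complex.re_le_norm lam)
    have := Real.sqrt_pos.2 hα
    refine (norm_jump_le x lam).trans ?_
    gcongr
  have hscalar : ‖(h : ℂ) / (2 * Real.pi * Complex.I)‖ = h / (2 * Real.pi) := by
    simp [abs_of_pos hh, abs_of_pos Real.pi_pos]
  have := Real.pi_pos
  rw [integrandExt, map_smul_eq_mul, norm_mul, norm_mul, norm_pow, hscalar]
  gcongr

theorem sqrt_mul_etaPlus_mul_sqrt {B L ρ : ℝ} (hL : 0 ≤ L) (hη : 0 ≤ etaPlus B ρ) (d : ℝ) :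
    d * Real.sqrt (L * etaPlus B ρ * Real.sqrt (1 + (ρ / 2) ^ 2)) = boundGrowth d B L ρ := by
  have hroot : (1 + (ρ / 2) ^ 2) ^ (1 / 4 : ℝ) = Real.sqrt (Real.sqrt (1 + (ρ / 2) ^ 2)) := by
    rw [Real.sqrt_eq_rpow, Real.sqrt_eq_rpow, ← Real.rpow_mul (by positivity)]
    norm_num
  rw [boundGrowth, hroot, Real.sqrt_mul (by positivity), Real.sqrt_mul hL, Real.sqrt_eq_rpow L,
    Real.sqrt_eq_rpow (etaPlus B ρ)]
  ring

theorem mul_boundFun_eq {B L ρ : ℝ} (Q n : ℕ) (h x C : ℝ) (hL : 0 < L) (hη : 0 < etaMinus B ρ)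
    (hη' : 0 ≤ etaPlus B ρ) :
    B * L / 2 * (8 * (h / (2 * Real.pi) * ((Real.sqrt (L * etaMinus B ρ))⁻¹ *
      Real.exp (|x| * Real.sqrt (L * etaPlus B ρ * Real.sqrt (1 + (ρ / 2) ^ 2)))) *
      Real.exp (-(n * h * R.gamma (h * (L * etaPlus B ρ)) * (L * etaMinus B ρ))) * C) *
      (ρ ^ (-2 * (Q : ℤ) + 1) / (ρ - 1))) =
    C * (h * (2 * B * L ^ (1 / 2 : ℝ) / Real.pi)) * boundFun R Q h |x| (n * h) B L ρ := by
  have hdecay : n * h * R.gamma (h * (L * etaPlus B ρ)) * (L * etaMinus B ρ) =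
      L * (n * h) * R.gamma (h * L * etaPlus B ρ) * etaMinus B ρ := by
    rw [← mul_assoc h L]
    ring
  have hsqrt : L * (Real.sqrt (L * etaMinus B ρ))⁻¹ =
      L ^ (1 / 2 : ℝ) * (etaMinus B ρ) ^ (-(1 / 2) : ℝ) := by
    rw [Real.sqrt_mul hL.le, mul_inv, ← mul_assoc, ← div_eq_mul_inv L, Real.div_sqrt,
      Real.rpow_neg hη.le, ← Real.sqrt_eq_rpow, ← Real.sqrt_eq_rpow]
  rw [boundFun_eq, sqrt_mul_etaPlus_mul_sqrt hL.le hη', hdecay,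
    sub_eq_add_neg (boundGrowth |x| B L ρ), Real.exp_add, boundPrefactor]
  linear_combination (2 * B * h / Real.pi * C * Real.exp (boundGrowth |x| B L ρ) *
    Real.exp (-(L * (n * h) * R.gamma (h * L * etaPlus B ρ) * etaMinus B ρ)) *
    (ρ ^ (-2 * (Q : ℤ) + 1) / (ρ - 1))) * hsqrt

theorem seminorm_gaussError_integrand_le (hA : R.AStable) (hR : R.StifflyAccurate)
    (N : Seminorm ℂ (Fin (m + 1) → ℂ)) {h B L : ℝ} (hh : 0 < h) (x : ℝ) (hB : 0 < B) (hL : 0 < L)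
    (n : ℕ) {Q : ℕ} (g : GaussLegendreRule Q) {ρ : ℝ} (hρ : ρ ∈ Set.Ioo 1 (rhoMax B)) :
    N (gaussError g (integrand R h x n) L ((1 + B) * L)) ≤
      sSup (R.qNorms N) * (h * (2 * B * L ^ (1 / 2 : ℝ) / Real.pi)) *
        boundFun R Q h |x| (n * h) B L ρ := by
  have hη := etaMinus_pos hB hρ.1.le hρ.2
  have hη' := one_le_etaPlus hB.le (one_pos.trans hρ.1).le
  have hlength : (1 + B) * L - L = B * L := by ring
  have herror := seminorm_gaussError_le N g (F := integrand R h x n) (Φ := integrandExt R h x n)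
    (a := L) (b := (1 + B) * L) (by nlinarith) hρ.1
    (fun y hy => integrand_eq hA hR hh.le x n (hL.le.trans hy.1))
    (fun w hw => differentiableAt_integrandExt hA hh.le x n
      ((mul_pos hL hη).trans_le (mul_etaMinus_le_re_transplant hB.le hL.le hw)))
    (fun w hw => seminorm_integrandExt_le hA hR N hh x n (mul_pos hL hη)
      (mul_etaMinus_le_re_transplant hB.le hL.le hw) (re_transplant_le_mul_etaPlus hB.le hL.le hw)
      (norm_transplant_le hB hL.le hρ hw))
  rwa [hlength, mul_boundFun_eq Q n h x _ hL hη (one_pos.le.trans hη')] at herror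

theorem endpoint_pos {B L₀ : ℝ} (hB : 0 ≤ B) (hL : 0 < L₀) : ∀ j, 0 < endpoint B L₀ j
  | 0 => hL
  | j + 1 => mul_pos (by linarith) (endpoint_pos hB hL j)

end QuadratureError

end SchrodingerCQ

theorem corollary4p6_general {m : ℕ} {R : SchrodingerCQ.RungeKutta m} (hA : R.AStable)
    (hR : R.StifflyAccurate) (N : Seminorm ℂ (Fin (m + 1) → ℂ)) :
    BddAbove (R.qNorms N) ∧
    ∀ (h x B L : ℝ), 0 < h → 0 < B → 0 < L → ∀ n Q : ℕ, ∃ M : ℝ,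
      IsLeast (SchrodingerCQ.boundFun R Q h |x| (n * h) B L '' Set.Ioo 1 (SchrodingerCQ.rhoMax B))
        M ∧
      ∀ g : SchrodingerCQ.GaussLegendreRule Q,
        N (SchrodingerCQ.gaussError g (SchrodingerCQ.integrand R h x n) L ((1 + B) * L)) ≤
          sSup (R.qNorms N) * (h * (2 * B * L ^ (1 / 2 : ℝ) / Real.pi)) * M := by
  refine ⟨SchrodingerCQ.RungeKutta.bddAbove_qNorms hA hR N, fun h x B L hh hB hL n Q => ?_⟩
  obtain ⟨ρ, hρ, hleast⟩ := SchrodingerCQ.exists_isLeast_boundFun (d := |x|) (t := n * h) Q hA hh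
    (abs_nonneg x) (by positivity) hB hL
  exact ⟨_, hleast, fun g =>
    SchrodingerCQ.seminorm_gaussError_integrand_le hA hR N hh x hB hL n g hρ⟩

theorem corollary4p6 {m : ℕ} (R : SchrodingerCQ.RungeKutta m) (hR : R.Admissible)
    (N : Seminorm ℂ (Fin (m + 1) → ℂ)) :
    BddAbove (R.qNorms N) ∧
    ∀ (h x B L₀ : ℝ), 0 < h → 1 ≤ B → 0 < L₀ →
      ∀ (n j Q : ℕ), 1 ≤ j → 1 ≤ Q →
        ∃ M : ℝ,
          IsLeast (SchrodingerCQ.boundFun R Q h |x| (n * h) B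
            (SchrodingerCQ.endpoint B L₀ (j - 1)) '' Set.Ioo 1 (SchrodingerCQ.rhoMax B)) M ∧
          ∀ g : SchrodingerCQ.GaussLegendreRule Q,
            N (SchrodingerCQ.tau R g h x B L₀ n j) ≤
              sSup (R.qNorms N) *
                (h * (2 * B * (SchrodingerCQ.endpoint B L₀ (j - 1)) ^ (1 / 2 : ℝ) / Real.pi)) *
                M := by
  obtain ⟨hbdd, hbound⟩ := corollary4p6_general hR.aStable hR.stifflyAccurate N
  refine ⟨hbdd, fun h x B L₀ hh hB hL₀ n j Q hj _ => ?_⟩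
  obtain ⟨k, rfl⟩ := Nat.exists_eq_add_of_le' hj
  have hB0 : 0 < B := one_pos.trans_le hB
  exact hbound h x B _ hh hB0 (SchrodingerCQ.endpoint_pos hB0.le hL₀ k) n Q
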